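/- Let $(R,\mathfrak m)$ be an excellent (in particular Noetherian) normal local ring of prime characteristic $p$, of Krull dimension $d$, whose residue field $R/\mathfrak m$ is algebraically closed. For an ideal $I$ and $q=p^e$ let $I^{[q]}$ be the ideal generated by the $q$-th powers of all elements of $I$, let $\ell$ denote length, and for an $\mathfrak m$-primary ideal $I$ let $$e_{HK}(I)=\lim_{e\to\infty}\frac{\ell(R/I^{[p^e]})}{p^{ed}}$$ be its Hilbert--Kunz multiplicity; put $e_{HK}(R)=e_{HK}(\mathfrak m)$. Then the limit $e_{HK}(I)$ exists for every $\mathfrak m$-primary ideal $I$, and the following hold. (1) If $I$ is an integrally closed $\mathfrak m$-primary ideal of $R$, then $$e_{HK}(I)\ \ge\ \ell(R/I)+e_{HK}(R)-1 .$$ (2) If $I$ is an $\mathfrak m$-primary ideal of $R$ for which there is an integrally closed ideal $K\subset I$ with $\ell(I/K)=1$, then $$e_{HK}(I)\ \ge\ \ell(R/I).$$ -/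

import Mathlib

open Filter Topology
open scoped TensorProduct

universe u

namespace HilbertKunz

/-! ### Excellent rings -/

/-- A commutative ring is catenary if for all primes `p ⊆ q` the lengths of the chains of primes
from `p` to `q` are bounded, and all maximal (that is, saturated) such chains have the same
length. -/
def IsCatenaryRing (A : Type u) [CommRing A] : Prop :=
  ∀ p q : PrimeSpectrum A, ∃ n : ℕ,
    (∀ c : LTSeries (PrimeSpectrum A), c.head = p → c.last = q → c.length ≤ n) ∧
    (∀ c : LTSeries (PrimeSpectrum A), c.head = p → c.last = q →
      (∀ i : Fin c.length, c i.castSucc ⋖ c i.succ) → c.length = n)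

/-- Every finite type algebra is catenary. -/
def IsUniversallyCatenary (R : Type u) [CommRing R] : Prop :=
  ∀ (A : Type u) [CommRing A] [Algebra R A], Algebra.FiniteType R A → IsCatenaryRing A

/-- An algebra `B` over a field `k` is geometrically regular if `L ⊗ B` is a (Noetherian) regular
ring for every finite field extension `L` of `k`. -/
def IsGeometricallyRegular (k : Type u) [Field k] (B : Type u) [CommRing B] [Algebra k B] : Prop :=
  ∀ (L : Type u) [Field L] [Algebra k L], Module.Finite k L → IsRegularRing (L ⊗[k] B)

/-- `A → B` is a regular ring homomorphism: it is flat and its fibres are geometrically regular. -/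
def IsRegularHom (A : Type u) [CommRing A] (B : Type u) [CommRing B] [Algebra A B] : Prop :=
  Module.Flat A B ∧
    ∀ (q : Ideal A) [q.IsPrime], IsGeometricallyRegular q.ResidueField (q.Fiber B)

/-- The formal fibre condition of a G-ring: for each prime `p`, the completion map of the local
ring `R_p` is regular. -/
def HasRegularFormalFibres (R : Type u) [CommRing R] : Prop :=
  ∀ (p : Ideal R) [p.IsPrime],
    IsRegularHom (Localization.AtPrime p)
      (AdicCompletion (IsLocalRing.maximalIdeal (Localization.AtPrime p))
        (Localization.AtPrime p))

/-- J-2: the regular locus of every finite type algebra is open. -/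
def IsJTwo (R : Type u) [CommRing R] : Prop :=
  ∀ (A : Type u) [CommRing A] [Algebra R A], Algebra.FiniteType R A →
    IsOpen {q : PrimeSpectrum A | IsRegularLocalRing (Localization.AtPrime q.asIdeal)}

/-- Excellent rings: Noetherian, universally catenary, G-ring and J-2. -/
class IsExcellentRing (R : Type u) [CommRing R] : Prop extends IsNoetherianRing R where
  universallyCatenary : IsUniversallyCatenary R
  regularFormalFibres : HasRegularFormalFibres R
  jTwo : IsJTwo R

/-! ### Integrally closed ideals -/

/-- `x` is integral over the ideal `I`: it satisfies an equation
`x ^ n + a₁ x ^ (n - 1) + ⋯ + aₙ = 0` with `n ≥ 1` and `aᵢ ∈ I ^ i`. -/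
def IsIntegralOverIdeal {R : Type u} [CommRing R] (I : Ideal R) (x : R) : Prop :=
  ∃ (n : ℕ) (a : ℕ → R), 1 ≤ n ∧ (∀ i ∈ Finset.Icc 1 n, a i ∈ I ^ i) ∧
    x ^ n + ∑ i ∈ Finset.Icc 1 n, a i * x ^ (n - i) = 0

/-- The ideal `I` contains every element that is integral over it. -/
def IsIntegrallyClosedIdeal {R : Type u} [CommRing R] (I : Ideal R) : Prop :=
  ∀ x : R, IsIntegralOverIdeal I x → x ∈ I

/-! ### Hilbert-Kunz multiplicity -/

/-- `I` is primary to the maximal ideal of the local ring `R`. -/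
def IsMaximalPrimary {R : Type u} [CommRing R] [IsLocalRing R] (I : Ideal R) : Prop :=
  I.radical = IsLocalRing.maximalIdeal R

/-- `I^{[q]}`, the ideal generated by the `q`-th powers of all elements of `I`. -/
def frobeniusPower {R : Type u} [CommRing R] (I : Ideal R) (q : ℕ) : Ideal R :=
  Ideal.span ((fun x : R => x ^ q) '' (I : Set R))

/-- `ℓ(R/I)` as a real number, for ideals with `R/I` of finite length. -/
noncomputable def colength {R : Type u} [CommRing R] (I : Ideal R) : ℝ :=
  ((Module.length R (R ⧸ I)).toNat : ℝ)

/-- The Krull dimension as a natural number, for nontrivial rings of finite dimension (such as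
Noetherian local rings). -/
noncomputable def krullDimNat (R : Type u) [CommRing R] : ℕ :=
  ((ringKrullDim R).unbotD 0).toNat

/-- The sequence `ℓ(R/I^{[p^e]}) / p^{e d}`, with `d = dim R`, indexed by `e`. -/
noncomputable def hkSeq {R : Type u} [CommRing R] (p : ℕ) (I : Ideal R) (e : ℕ) : ℝ :=
  colength (frobeniusPower I (p ^ e)) / ((p : ℝ) ^ e) ^ krullDimNat R

/-- The Hilbert-Kunz multiplicity `e_HK(I)`, the limit of `ℓ(R/I^{[p^e]}) / p^{e d}`. -/
noncomputable def hkMultiplicity {R : Type u} [CommRing R] (p : ℕ) (I : Ideal R) : ℝ :=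
  limUnder atTop (hkSeq p I)

end HilbertKunz

open HilbertKunz

open HilbertKunz

namespace HilbertKunz

/-! ### Generators, length and integrality -/

/-! Write `F^e` for `R` viewed as a module over itself through the `e`-th Frobenius, and `q = p^e`.
Because the residue field is perfect, `F^e / I F^e` has the length of `R / I^{[q]}`, so Hilbert-Kunz
questions concern the finite modules `F^e`, which have rank `q^d`.

The key estimate (`length_quotient_smul_add_finrank_le`): if `K < I` with `K` integrally closed and
`M` is finite, then `IM / KM` has length at least `rank M`. With fewer generators, factoring out
lifts `N` of them would leave a faithful module `M/N` with `I(M/N) = K(M/N)`, and the determinant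
trick would make `I` integral over `K`. Over an algebraically closed residue field, two nested
integrally closed ideals are joined by a chain of integrally closed ideals with steps of colength
one, found through maximal ideals of the Rees algebra. Summing the estimate along a chain from the
maximal ideal `m` down to `I`, with `M = F^e`, and dividing by `q^d` proves (1). For (2), `I = K +
(x)` with `mx ⊆ K` gives `e_HK(K) ≤ e_HK(R) + e_HK(I)`; then apply (1) to `K`.

The limit exists because a finite module of rank `r` agrees with `R^r` up to an error of order
`q^{d-1}`, so the normalised colengths form a Cauchy sequence. The same comparison yields the rank
of `F^e`.

All this needs a finite Frobenius, which is where excellence enters: the generic formal fibre is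
geometrically reduced, so finite generation descends from the completion
(`frobenius_finite_of_isRegularHom`). -/

theorem exists_finset_span_eq_top_of_isFiniteLength {R M : Type*} [Ring R] [AddCommGroup M]
    [Module R M] (h : IsFiniteLength R M) :
    ∃ s : Finset M, (s.card : ℕ∞) ≤ Module.length R M ∧ Submodule.span R (s : Set M) = ⊤ := by
  classical
  induction h with
  | of_subsingleton => exact ⟨∅, by simp, Subsingleton.elim _ _⟩
  | @of_simple_quotient M _ _ N _ hN ih =>
    obtain ⟨s, hs, hspan⟩ := ih
    have := IsSimpleModule.nontrivial R (M ⧸ N)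
    obtain ⟨y, hy⟩ := exists_ne (0 : M ⧸ N)
    obtain ⟨x, rfl⟩ := N.mkQ_surjective y
    refine ⟨insert x (s.image N.subtype), ?_, ?_⟩
    · rw [Module.length_eq_add_of_exact N.subtype N.mkQ N.injective_subtype N.mkQ_surjective
        (LinearMap.exact_subtype_mkQ N), Module.length_eq_one R (M ⧸ N)]
      refine le_trans ?_ (add_le_add_left hs 1)
      exact_mod_cast (Finset.card_insert_le _ _).trans (by gcongr; exact Finset.card_image_le)
    · have h1 : N ≤ Submodule.span R ((insert x (s.image N.subtype) : Finset M) : Set M) := by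
        calc N = (⊤ : Submodule R N).map N.subtype := by simp
          _ = Submodule.span R (N.subtype '' s) := by rw [← hspan, Submodule.map_span]
          _ ≤ _ := Submodule.span_mono (by simp)
      have h2 : (Submodule.span R ((insert x (s.image N.subtype) : Finset M) : Set M)).map N.mkQ
          = ⊤ := by
        refine (IsSimpleOrder.eq_bot_or_eq_top _).resolve_left fun hb => hy ?_
        have : N.mkQ x ∈ (⊥ : Submodule R (M ⧸ N)) := hb ▸ Submodule.mem_map_of_mem
          (Submodule.subset_span (by simp))
        simpa using this
      have := congrArg (Submodule.comap N.mkQ) h2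
      rwa [Submodule.comap_map_mkQ, sup_eq_right.mpr h1, Submodule.comap_top] at this

theorem length_quotient_eq_add {R M : Type*} [Ring R] [AddCommGroup M] [Module R M]
    {N₁ N₂ : Submodule R M} (h : N₁ ≤ N₂) :
    Module.length R (M ⧸ N₁) = Module.length R (N₂.map N₁.mkQ) + Module.length R (M ⧸ N₂) := by
  rw [← (Submodule.quotientQuotientEquivQuotient N₁ N₂ h).length_eq]
  exact Module.length_eq_add_of_exact _ _ (Submodule.injective_subtype _)
    (Submodule.mkQ_surjective _) (LinearMap.exact_subtype_mkQ _)

theorem length_quotient_eq_add_submoduleOf {R M : Type*} [CommRing R] [AddCommGroup M] [Module R M]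
    {N₁ N₂ : Submodule R M} (h : N₁ ≤ N₂) :
    Module.length R (M ⧸ N₁) =
      Module.length R (N₂ ⧸ N₁.submoduleOf N₂) + Module.length R (M ⧸ N₂) := by
  have hle : N₁.submoduleOf N₂ ≤ N₁.comap N₂.subtype := le_rfl
  refine Module.length_eq_add_of_exact ((N₁.submoduleOf N₂).mapQ N₁ N₂.subtype hle)
    (N₁.mapQ N₂ LinearMap.id (by simpa using h)) ?_ ?_ ?_
  · rw [← LinearMap.ker_eq_bot, Submodule.mapQ, Submodule.ker_liftQ_eq_bot]
    rw [LinearMap.ker_comp, Submodule.ker_mkQ]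
    exact le_rfl
  · rw [← LinearMap.range_eq_top, Submodule.range_mapQ]
    simp
  · rw [LinearMap.exact_iff, Submodule.ker_mapQ, Submodule.range_mapQ]
    simp

/-- The determinant trick: Cayley-Hamilton gives a monic polynomial with coefficients in the right
powers of `I` that annihilates multiplication by `x`, and faithfulness turns this into an equation
in `R`. -/
theorem isIntegralOverIdeal_of_smul_mem {R : Type u} [CommRing R] [Nontrivial R] {M : Type*}
    [AddCommGroup M] [Module R M] [Module.Finite R M] [FaithfulSMul R M] (I : Ideal R) (x : R)
    (h : ∀ m : M, x • m ∈ I • (⊤ : Submodule R M)) : IsIntegralOverIdeal I x := by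
  obtain ⟨P, hP, -, hc, h0⟩ :=
    LinearMap.exists_monic_and_natDegree_eq_and_coeff_mem_pow_and_aeval_eq_zero R
      (algebraMap R (Module.End R M) x) I (by rintro _ ⟨m, rfl⟩; exact h m)
  have hev : P.eval x = 0 := by
    rw [Polynomial.aeval_algebraMap_apply] at h0
    apply FaithfulSMul.eq_of_smul_eq_smul (M := R) (α := M)
    intro m
    have := LinearMap.congr_fun h0 m
    simpa using this
  have hdeg : 1 ≤ P.natDegree := by
    by_contra! hlt
    rw [hP.natDegree_eq_zero.mp (by omega)] at hev
    simp at hev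
  refine ⟨P.natDegree, fun i => P.coeff (P.natDegree - i), hdeg, fun i hi => ?_, ?_⟩
  · have := hc (P.natDegree - i)
    rwa [Nat.sub_sub_self (Finset.mem_Icc.mp hi).2] at this
  · rw [← hev, Polynomial.eval_eq_sum_range, Finset.sum_range_succ, hP.coeff_natDegree, one_mul,
      add_comm, add_left_inj]
    refine Finset.sum_bij' (fun i _ => P.natDegree - i) (fun i _ => P.natDegree - i) ?_ ?_ ?_ ?_ ?_
    all_goals simp only [Finset.mem_Icc, Finset.mem_range]
    all_goals intro i hi; first | trivial | omega

theorem faithfulSMul_of_rank_ne_zero {R : Type*} [CommRing R] [IsDomain R] {M : Type*}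
    [AddCommGroup M] [Module R M] (h : Module.rank R M ≠ 0) : FaithfulSMul R M := by
  rw [ne_eq, rank_eq_zero_iff] at h
  push Not at h
  obtain ⟨x, hx⟩ := h
  refine ⟨fun {a b} hab => ?_⟩
  by_contra hne
  exact hx (a - b) (sub_ne_zero.mpr hne) (by rw [sub_smul, hab, sub_self])

/-- A module of length below `rank M` needs fewer than `rank M` generators. Lifting generators of
`IM/KM` to a submodule `N` gives `IM ⊆ KM + N`, while `M/N` keeps positive rank and is therefore
faithful. -/
theorem length_quotient_smul_add_finrank_le {R : Type u} [CommRing R] [IsDomain R]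
    {M : Type*} [AddCommGroup M] [Module R M] [Module.Finite R M] {I K : Ideal R}
    (hK : IsIntegrallyClosedIdeal K) (hlt : K < I) :
    Module.length R (M ⧸ I • (⊤ : Submodule R M)) + Module.finrank R M ≤
      Module.length R (M ⧸ K • (⊤ : Submodule R M)) := by
  classical
  set N₁ := K • (⊤ : Submodule R M)
  set N₂ := I • (⊤ : Submodule R M)
  have hN : N₁ ≤ N₂ := Submodule.smul_mono_left hlt.le
  rw [length_quotient_eq_add hN, add_comm]
  gcongr
  by_contra! hlen
  set L := N₂.map N₁.mkQ
  obtain ⟨s, hs, hspan⟩ := exists_finset_span_eq_top_of_isFiniteLength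
    (Module.length_ne_top_iff.mp hlen.ne_top : IsFiniteLength R L)
  have hcard : s.card < Module.finrank R M := by exact_mod_cast hs.trans_lt hlen
  choose g hg using N₁.mkQ_surjective
  set t : Finset M := s.image (fun y : L => g (y : M ⧸ N₁))
  set N := Submodule.span R (t : Set M)
  have hLN : L ≤ N.map N₁.mkQ := by
    calc L = (⊤ : Submodule R L).map L.subtype := by simp
      _ = Submodule.span R (L.subtype '' s) := by rw [← hspan, Submodule.map_span]
      _ ≤ N.map N₁.mkQ := by
        rw [Submodule.map_span]
        refine Submodule.span_mono ?_
        rintro _ ⟨y, hy, rfl⟩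
        exact ⟨g y, by simpa [t] using ⟨y, ⟨y.2, hy⟩, rfl⟩, hg y⟩
  have hsub : N₂ ≤ N₁ ⊔ N := by
    have := (Submodule.map_le_iff_le_comap (f := N₁.mkQ)).mp hLN
    rwa [Submodule.comap_map_mkQ] at this
  have hrank : Module.rank R (M ⧸ N) ≠ 0 := by
    intro h0
    have h1 := rank_quotient_add_rank_of_isDomain N
    rw [h0, zero_add, ← Module.finrank_eq_rank R M] at h1
    have h2 := rank_span_finset_le (R := R) t
    rw [h1] at h2
    have h3 : Module.finrank R M ≤ t.card := by exact_mod_cast h2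
    exact absurd (h3.trans Finset.card_image_le) (not_le.mpr hcard)
  have := faithfulSMul_of_rank_ne_zero hrank
  obtain ⟨x, hxI, hxK⟩ := SetLike.exists_of_lt hlt
  refine hxK (hK x (isIntegralOverIdeal_of_smul_mem (M := M ⧸ N) K x fun m => ?_))
  obtain ⟨m, rfl⟩ := N.mkQ_surjective m
  have h1 : x • m ∈ N₁ ⊔ N := hsub (Submodule.smul_mem_smul hxI trivial)
  have h2 := Submodule.mem_map_of_mem (f := N.mkQ) h1
  rw [Submodule.map_sup, Submodule.map_smul''] at h2
  simp only [Submodule.map_top, Submodule.range_mkQ, N, Submodule.mkQ_map_self, sup_bot_eq] at h2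
  rwa [map_smul] at h2

theorem IsIntegralOverIdeal.mono {R : Type u} [CommRing R] {I J : Ideal R} (h : I ≤ J) {x : R}
    (hx : IsIntegralOverIdeal I x) : IsIntegralOverIdeal J x := by
  obtain ⟨n, a, hn, ha, h0⟩ := hx
  exact ⟨n, a, hn, fun i hi => Ideal.pow_right_mono h i (ha i hi), h0⟩

theorem isIntegrallyClosedIdeal_of_isPrime {R : Type u} [CommRing R] (I : Ideal R) [hI : I.IsPrime] :
    IsIntegrallyClosedIdeal I := by
  rintro x ⟨n, a, hn, ha, h0⟩
  refine hI.mem_of_pow_mem n ?_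
  rw [eq_neg_of_add_eq_zero_left h0]
  refine I.neg_mem (I.sum_mem fun i hi => I.mul_mem_right _ ?_)
  exact Ideal.pow_le_self (by have := Finset.mem_Icc.mp hi; omega) (ha i hi)

/-! ### Chains of integrally closed ideals -/

section ResidueFieldAlgebra

/-- The algebra structure over the residue field of an algebra killed by the maximal ideal. -/
abbrev residueFieldAlgebra {R : Type*} [CommRing R] [IsLocalRing R] {C : Type*} [CommRing C]
    [Algebra R C] (h : ∀ x ∈ IsLocalRing.maximalIdeal R, algebraMap R C x = 0) :
    Algebra (IsLocalRing.ResidueField R) C :=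
  (Ideal.Quotient.lift (IsLocalRing.maximalIdeal R) (algebraMap R C) h).toAlgebra

theorem residueFieldAlgebra_finiteType {R : Type*} [CommRing R] [IsLocalRing R] {C : Type*}
    [CommRing C] [Algebra R C] [Algebra.FiniteType R C]
    (h : ∀ x ∈ IsLocalRing.maximalIdeal R, algebraMap R C x = 0) :
    letI := residueFieldAlgebra h
    Algebra.FiniteType (IsLocalRing.ResidueField R) C := by
  let := residueFieldAlgebra h
  have : IsScalarTower R (IsLocalRing.ResidueField R) C := .of_algebraMap_eq fun _ => rfl
  exact Algebra.FiniteType.of_restrictScalars_finiteType R _ _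

end ResidueFieldAlgebra

/-- `B/a` is of finite type over the residue field, hence Jacobson, so the radical of `a` is the
intersection of the maximal ideals above it. -/
theorem exists_pow_le_of_forall_isMaximal {R : Type*} [CommRing R] [IsLocalRing R] {B : Type*}
    [CommRing B] [Algebra R B] [Algebra.FiniteType R B] {a J : Ideal B}
    (ha : (IsLocalRing.maximalIdeal R).map (algebraMap R B) ≤ a) (hJ : J.FG)
    (h : ∀ M : Ideal B, M.IsMaximal → a ≤ M → J ≤ M) : ∃ n, J ^ n ≤ a := by
  have h0 : ∀ x ∈ IsLocalRing.maximalIdeal R, algebraMap R (B ⧸ a) x = 0 := fun x hx =>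
    Ideal.Quotient.eq_zero_iff_mem.mpr (ha (Ideal.mem_map_of_mem _ hx))
  let := residueFieldAlgebra h0
  have := residueFieldAlgebra_finiteType h0
  have : IsJacobsonRing (B ⧸ a) := isJacobsonRing_of_finiteType (A := IsLocalRing.ResidueField R)
  have hrad : a.radical = a.jacobson :=
    Ideal.radical_eq_jacobson_iff_radical_quotient_eq_jacobson_bot.mpr (Ideal.radical_eq_jacobson _)
  refine Ideal.exists_pow_le_of_le_radical_of_fg ?_ hJ
  rw [hrad, Ideal.jacobson]
  exact le_sInf fun M hM => h M hM.2 hM.1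

/-- Nullstellensatz: `B/M` is a finite extension of an algebraically closed field, hence equal to
it. -/
theorem algebraMap_quotient_surjective_of_isMaximal {R : Type*} [CommRing R] [IsLocalRing R]
    [IsAlgClosed (IsLocalRing.ResidueField R)] {B : Type*}
    [CommRing B] [Algebra R B] [Algebra.FiniteType R B] (M : Ideal B) [M.IsMaximal]
    (hM : (IsLocalRing.maximalIdeal R).map (algebraMap R B) ≤ M) :
    Function.Surjective (algebraMap R (B ⧸ M)) := by
  have h0 : ∀ x ∈ IsLocalRing.maximalIdeal R, algebraMap R (B ⧸ M) x = 0 := fun x hx =>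
    Ideal.Quotient.eq_zero_iff_mem.mpr (hM (Ideal.mem_map_of_mem _ hx))
  let := residueFieldAlgebra h0
  have := residueFieldAlgebra_finiteType h0
  let := Ideal.Quotient.field M
  have : Module.Finite (IsLocalRing.ResidueField R) (B ⧸ M) :=
    finite_of_finite_type_of_isJacobsonRing _ _
  have hs := (IsAlgClosed.algebraMap_bijective_of_isIntegral
    (k := IsLocalRing.ResidueField R) (K := B ⧸ M)).2
  intro y
  obtain ⟨z, rfl⟩ := hs y
  obtain ⟨r, rfl⟩ := Ideal.Quotient.mk_surjective z
  exact ⟨r, rfl⟩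

/-! ### The Rees algebra and its graded pieces -/

section Rees

variable {R : Type u} [CommRing R] (I : Ideal R)

/-- The degree `i` component of the Rees algebra. -/
noncomputable def reesMonomial (i : ℕ) : (I ^ i : Ideal R) →ₗ[R] reesAlgebra I where
  toFun f := ⟨Polynomial.monomial i (f : R), reesAlgebra.monomial_mem.mpr f.2⟩
  map_add' f g := by ext1; simp
  map_smul' r f := by ext1; simp [Polynomial.smul_monomial]

theorem coe_reesMonomial (i : ℕ) (f : (I ^ i : Ideal R)) :
    (reesMonomial I i f : Polynomial R) = Polynomial.monomial i (f : R) := rfl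

/-- The linear embedding of `I` as the degree one part of the Rees algebra. -/
noncomputable def reesDegreeOne : I →ₗ[R] reesAlgebra I :=
  reesMonomial I 1 ∘ₗ (LinearEquiv.ofEq I (I ^ 1) (pow_one I).symm).toLinearMap

theorem coe_reesDegreeOne (f : I) :
    (reesDegreeOne I f : Polynomial R) = Polynomial.monomial 1 (f : R) := rfl

variable {I}

/-- The degree `n` part of the ideal of the Rees algebra of `I` generated by `m` in degree zero and
by `K` in degree one. -/
def reesIdealPart (I m K : Ideal R) : ℕ → Ideal R
  | 0 => m
  | n + 1 => K * I ^ n ⊔ m * I ^ (n + 1)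

theorem pow_mul_reesIdealPart_le (m K : Ideal R) (i j : ℕ) :
    I ^ i * reesIdealPart I m K j ≤ reesIdealPart I m K (j + i) := by
  match i, j with
  | 0, j => simp
  | i + 1, 0 =>
    rw [zero_add, mul_comm]
    exact le_sup_right
  | i, j + 1 =>
    rw [add_right_comm, reesIdealPart, reesIdealPart, Ideal.mul_sup, pow_add, pow_add, pow_add]
    refine sup_le_sup (le_of_eq (by ring)) (le_of_eq (by ring))

/-- This reads off, degree by degree, what membership in the ideal `(m, Kt)` of the Rees algebra
means in `R`. -/
theorem coeff_mem_of_mem_reesIdeal {m K : Ideal R} {b : reesAlgebra I}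
    (hb : b ∈ m.map (algebraMap R (reesAlgebra I)) ⊔
      Ideal.span (reesDegreeOne I '' {f | (f : R) ∈ K})) (n : ℕ) :
    (b : Polynomial R).coeff n ∈ reesIdealPart I m K n := by
  rw [Ideal.map, ← Ideal.span_union] at hb
  induction hb using Submodule.span_induction generalizing n with
  | mem x hx =>
    rcases hx with ⟨r, hr, rfl⟩ | ⟨f, hf, rfl⟩
    · have : ((algebraMap R (reesAlgebra I) r : reesAlgebra I) : Polynomial R) =
          Polynomial.C r := rfl
      rw [this, Polynomial.coeff_C]
      split_ifs with h
      · rw [h]; exact hr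
      · exact zero_mem _
    · rw [coe_reesDegreeOne, Polynomial.coeff_monomial]
      split_ifs with h
      · rw [← h]
        exact Ideal.mem_sup_left (by simpa using hf)
      · exact zero_mem _
  | zero => simp
  | add x y _ _ hx hy => simpa using add_mem (hx n) (hy n)
  | smul c x hx ih =>
    rw [smul_eq_mul, MulMemClass.coe_mul, Polynomial.coeff_mul]
    refine Ideal.sum_mem _ fun ij hij => ?_
    rw [← Finset.HasAntidiagonal.mem_antidiagonal.mp hij, add_comm]
    exact pow_mul_reesIdealPart_le m K _ _ (Ideal.mul_mem_mul (c.2 _) (ih _))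

theorem pow_mem_reesDegreeOne_span {n : ℕ} {r : R} (hr : r ∈ I ^ n) :
    reesMonomial I n ⟨r, hr⟩ ∈ Ideal.span (Set.range (reesDegreeOne I)) ^ n := by
  induction n generalizing r with
  | zero => simp
  | succ n ih =>
    rw [pow_succ] at hr
    induction hr using Submodule.mul_induction_on' with
    | mem_mul_mem a ha b hb =>
      have : reesMonomial I (n + 1) ⟨a * b, by rw [pow_succ]; exact Ideal.mul_mem_mul ha hb⟩ =
          reesMonomial I n ⟨a, ha⟩ * reesDegreeOne I ⟨b, hb⟩ := by
        ext1
        simp [coe_reesMonomial, coe_reesDegreeOne, Polynomial.monomial_mul_monomial]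
      rw [this, pow_succ]
      exact Ideal.mul_mem_mul (ih ha) (Ideal.subset_span ⟨_, rfl⟩)
    | add x hx y hy h1 h2 =>
      rw [← pow_succ] at hx hy
      have : reesMonomial I (n + 1) ⟨x + y, add_mem hx hy⟩ =
          reesMonomial I (n + 1) ⟨x, hx⟩ + reesMonomial I (n + 1) ⟨y, hy⟩ := by
        rw [← map_add]; rfl
      rw [this]
      exact add_mem (h1 hx) (h2 hy)

theorem reesMonomial_mem_of_mem_pow {K : Ideal R} (hK : K ≤ I) {M : Ideal (reesAlgebra I)}
    (hM : ∀ f : I, (f : R) ∈ K → reesDegreeOne I f ∈ M) {n : ℕ} (hn : 1 ≤ n) {r : R}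
    (hr : r ∈ K ^ n) : reesMonomial I n ⟨r, Ideal.pow_right_mono hK n hr⟩ ∈ M := by
  obtain ⟨n, rfl⟩ := Nat.exists_eq_add_of_le' hn
  rw [pow_succ] at hr
  induction hr using Submodule.mul_induction_on' with
  | mem_mul_mem a ha b hb =>
    have : reesMonomial I (n + 1) ⟨a * b, by
          rw [pow_succ]; exact Ideal.mul_mem_mul (Ideal.pow_right_mono hK n ha) (hK hb)⟩ =
        reesMonomial I n ⟨a, Ideal.pow_right_mono hK n ha⟩ * reesDegreeOne I ⟨b, hK hb⟩ := by
      ext1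
      simp [coe_reesMonomial, coe_reesDegreeOne, Polynomial.monomial_mul_monomial]
    rw [this]
    exact M.mul_mem_left _ (hM _ hb)
  | add x hx y hy h1 h2 =>
    rw [← pow_succ] at hx hy
    have : reesMonomial I (n + 1) ⟨x + y, add_mem (Ideal.pow_right_mono hK _ hx)
          (Ideal.pow_right_mono hK _ hy)⟩ =
        reesMonomial I (n + 1) ⟨x, Ideal.pow_right_mono hK _ hx⟩ +
          reesMonomial I (n + 1) ⟨y, Ideal.pow_right_mono hK _ hy⟩ := by
      rw [← map_add]; rfl
    rw [this]
    exact add_mem (h1 hx) (h2 hy)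

end Rees

/-- If a power of `I` lies in the ideal of the Rees algebra generated by the maximal ideal and by
`K` in degree one, then `I` is integral over `K`. -/
theorem le_of_pow_le_reesIdeal {R : Type u} [CommRing R] [IsNoetherianRing R] [IsLocalRing R]
    [IsDomain R] {I K : Ideal R} (hK : IsIntegrallyClosedIdeal K) (hI : I ≠ ⊥) {n : ℕ}
    (h : Ideal.span (Set.range (reesDegreeOne I)) ^ n ≤
      (IsLocalRing.maximalIdeal R).map (algebraMap R (reesAlgebra I)) ⊔
        Ideal.span (reesDegreeOne I '' {f | (f : R) ∈ K})) : I ≤ K := by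
  -- In degree `n + 1` the hypothesis says `I^{n+1} ⊆ K I^n + m I^{n+1}`; Nakayama removes the last
  -- term.
  have h1 : I ^ (n + 1) ≤ K * I ^ n := by
    refine Submodule.le_of_le_smul_of_le_jacobson_bot (I := IsLocalRing.maximalIdeal R)
      (IsNoetherian.noetherian _) (IsLocalRing.maximalIdeal_le_jacobson _) fun r hr => ?_
    have h2 := coeff_mem_of_mem_reesIdeal
      (h (Ideal.pow_le_pow_right n.le_succ (pow_mem_reesDegreeOne_span hr))) (n + 1)
    rw [coe_reesMonomial] at h2
    simpa [reesIdealPart] using h2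
  intro x hx
  have hne : I ^ n ≠ ⊥ := pow_ne_zero n hI
  have : FaithfulSMul R (I ^ n : Ideal R) := by
    obtain ⟨y, hy, hy0⟩ := Submodule.exists_mem_ne_zero_of_ne_bot hne
    refine ⟨fun {a b} hab => ?_⟩
    have := congrArg Subtype.val (hab ⟨y, hy⟩)
    exact mul_right_cancel₀ hy0 this
  -- The determinant trick is applied to the faithful module `I^n`, which `x` sends into `K I^n`.
  refine hK x (isIntegralOverIdeal_of_smul_mem (M := (I ^ n : Ideal R)) K x fun m => ?_)
  have h3 : x * m ∈ K * I ^ n := h1 (by rw [pow_succ']; exact Ideal.mul_mem_mul hx m.2)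
  have h4 : (K • (⊤ : Submodule R (I ^ n : Ideal R))).map (I ^ n).subtype = K * I ^ n := by
    rw [Submodule.map_smul'', Submodule.map_top, Submodule.range_subtype]; rfl
  rw [← h4] at h3
  obtain ⟨z, hz, hzx⟩ := h3
  rwa [show x • m = z from Subtype.ext hzx.symm]

/-- Between two integrally closed ideals there is an integrally closed ideal of relative
colength one in the larger one. -/
theorem exists_isIntegrallyClosedIdeal_length_eq_one {R : Type u} [CommRing R] [IsNoetherianRing R]
    [IsLocalRing R] [IsDomain R] [IsAlgClosed (IsLocalRing.ResidueField R)] {I K : Ideal R}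
    (hI : IsIntegrallyClosedIdeal I) (hK : IsIntegrallyClosedIdeal K) (hlt : K < I) :
    ∃ J : Ideal R, K ≤ J ∧ J < I ∧ IsIntegrallyClosedIdeal J ∧
      Module.length R (I ⧸ J.submoduleOf I) = 1 := by
  -- Were there no such `M`, a power of the ideal `(It)` would lie in `(m, Kt)`, forcing `I ≤ K`.
  obtain ⟨M, hMmax, hMa, hMJ⟩ : ∃ M : Ideal (reesAlgebra I), M.IsMaximal ∧
      (IsLocalRing.maximalIdeal R).map (algebraMap R (reesAlgebra I)) ⊔
        Ideal.span (reesDegreeOne I '' {f | (f : R) ∈ K}) ≤ M ∧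
      ¬ Ideal.span (Set.range (reesDegreeOne I)) ≤ M := by
    by_contra! hcon
    obtain ⟨n, hn⟩ := exists_pow_le_of_forall_isMaximal le_sup_left
      (IsNoetherian.noetherian (Ideal.span (Set.range (reesDegreeOne I)))) hcon
    exact not_le_of_gt hlt (le_of_pow_le_reesIdeal hK (ne_bot_of_gt hlt) hn)
  have hsurj := algebraMap_quotient_surjective_of_isMaximal M (le_sup_left.trans hMa)
  let φ : I →ₗ[R] reesAlgebra I ⧸ M := (Ideal.Quotient.mkₐ R M).toLinearMap ∘ₗ reesDegreeOne I
  have hφ : ∀ f, φ f = 0 ↔ reesDegreeOne I f ∈ M := fun f => Ideal.Quotient.eq_zero_iff_mem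
  let : Field (reesAlgebra I ⧸ M) := Ideal.Quotient.field M
  have hφs : Function.Surjective φ := by
    have : ∃ f, φ f ≠ 0 := by
      by_contra! hcon
      exact hMJ (Ideal.span_le.mpr (by rintro _ ⟨f, rfl⟩; exact (hφ f).mp (hcon f)))
    obtain ⟨f, hf⟩ := this
    intro y
    obtain ⟨r, hr⟩ := hsurj (y / φ f)
    refine ⟨r • f, ?_⟩
    rw [map_smul, Algebra.smul_def, hr, div_mul_cancel₀ _ hf]
  -- `J` consists of the `f ∈ I` with `ft ∈ M`; since the residue field of `M` is that of `R`, it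
  -- has relative colength one in `I`.
  set J : Ideal R := (LinearMap.ker φ).map I.subtype
  have hJI : J ≤ I := Submodule.map_subtype_le _ _
  have hsub : J.submoduleOf I = LinearMap.ker φ :=
    Submodule.comap_map_eq_of_injective I.injective_subtype _
  have hmemJ : ∀ f : I, (f : R) ∈ J ↔ reesDegreeOne I f ∈ M := fun f => by
    rw [← hφ, ← LinearMap.mem_ker, ← hsub]; rfl
  have hlen : Module.length R (I ⧸ J.submoduleOf I) = 1 := by
    rw [hsub, (φ.quotKerEquivOfSurjective hφs).length_eq,
      Module.length_eq_of_surjective (R := reesAlgebra I ⧸ M) hsurj, Module.length_eq_one]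
  refine ⟨J, fun x hx => ?_, lt_of_le_of_ne hJI ?_, fun x hx => ?_, hlen⟩
  · exact (hmemJ ⟨x, hlt.le hx⟩).mpr (hMa (Ideal.mem_sup_right
      (Ideal.subset_span ⟨⟨x, hlt.le hx⟩, hx, rfl⟩)))
  · intro h
    rw [h, Submodule.submoduleOf_self] at hlen
    rw [Module.length_eq_zero] at hlen
    exact zero_ne_one hlen
  -- Multiplying the integral equation by `t^n` expresses `(xt)^n` through the `a_i t^i` with `a_i ∈
  -- J^i`, all of which lie in `M`; primality then gives `xt ∈ M`.
  · have hxI : x ∈ I := hI x (hx.mono hJI)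
    obtain ⟨n, a, hn, ha, h0⟩ := hx
    refine (hmemJ ⟨x, hxI⟩).mpr (hMmax.isPrime.mem_of_pow_mem n ?_)
    have hpow : ∀ k, ((reesDegreeOne I ⟨x, hxI⟩ ^ k : reesAlgebra I) : Polynomial R) =
        Polynomial.monomial k (x ^ k) := fun k => by
      rw [SubmonoidClass.coe_pow, coe_reesDegreeOne, Polynomial.monomial_pow, one_mul]
    have hmem : ∀ i : Finset.Icc 1 n, reesMonomial I i ⟨a i, Ideal.pow_right_mono hJI _ (ha i i.2)⟩
        ∈ M := fun i => reesMonomial_mem_of_mem_pow hJI (fun f => (hmemJ f).mp)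
          (Finset.mem_Icc.mp i.2).1 (ha i i.2)
    have hsum : reesDegreeOne I ⟨x, hxI⟩ ^ n = -∑ i : Finset.Icc 1 n,
        reesMonomial I i ⟨a i, Ideal.pow_right_mono hJI _ (ha i i.2)⟩ *
          reesDegreeOne I ⟨x, hxI⟩ ^ (n - i) := by
      ext1
      rw [hpow, eq_neg_of_add_eq_zero_left h0, NegMemClass.coe_neg, AddSubmonoidClass.coe_finsetSum,
        ← Finset.sum_coe_sort, map_neg, map_sum]
      congr 1
      refine Finset.sum_congr rfl fun i _ => ?_
      rw [MulMemClass.coe_mul, hpow, coe_reesMonomial, Polynomial.monomial_mul_monomial,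
        Nat.add_sub_cancel' (Finset.mem_Icc.mp i.2).2]
    rw [hsum]
    exact M.neg_mem (M.sum_mem fun i _ => M.mul_mem_right _ (hmem i))

theorem length_quotient_eq_add_one {R : Type u} [CommRing R] {I J : Ideal R} (h : J ≤ I)
    (hlen : Module.length R (I ⧸ J.submoduleOf I) = 1) :
    Module.length R (R ⧸ J) = Module.length R (R ⧸ I) + 1 := by
  rw [length_quotient_eq_add_submoduleOf h, hlen, add_comm]

/-- Colength inequality for finite modules along integrally closed ideals. -/
theorem length_quotient_smul_le_of_isIntegrallyClosedIdeal {R : Type u} [CommRing R]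
    [IsNoetherianRing R] [IsLocalRing R] [IsDomain R] [IsAlgClosed (IsLocalRing.ResidueField R)]
    {M : Type*} [AddCommGroup M] [Module R M] [Module.Finite R M] {I K : Ideal R}
    (hI : IsIntegrallyClosedIdeal I) (hK : IsIntegrallyClosedIdeal K) (hle : K ≤ I)
    (hfin : Module.length R (R ⧸ K) ≠ ⊤) :
    Module.length R (M ⧸ I • (⊤ : Submodule R M)) +
        Module.finrank R M * Module.length R (R ⧸ K) ≤
      Module.length R (M ⧸ K • (⊤ : Submodule R M)) +
        Module.finrank R M * Module.length R (R ⧸ I) := by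
  have hlenle : ∀ J : Ideal R, K ≤ J → Module.length R (R ⧸ J) ≤ Module.length R (R ⧸ K) :=
    fun J hJ => Module.length_le_of_surjective (Submodule.factor hJ) (Submodule.factor_surjective _)
  obtain ⟨k, hk⟩ := ENat.ne_top_iff_exists.mp hfin
  -- Induction on a bound `n` for the colength of `K` in `I`: each step replaces `I` by an
  -- integrally closed ideal one unit of colength below it.
  suffices ∀ n : ℕ, ∀ I : Ideal R, IsIntegrallyClosedIdeal I → K ≤ I →
      Module.length R (R ⧸ K) ≤ Module.length R (R ⧸ I) + n →
      Module.length R (M ⧸ I • (⊤ : Submodule R M)) +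
        Module.finrank R M * Module.length R (R ⧸ K) ≤
      Module.length R (M ⧸ K • (⊤ : Submodule R M)) +
        Module.finrank R M * Module.length R (R ⧸ I) by
    refine this k I hI hle ?_
    rw [← hk]
    exact le_add_self
  intro n
  induction n with
  | zero =>
    intro I hI hle hn
    rcases hle.eq_or_lt with rfl | hlt
    · exact le_rfl
    obtain ⟨J, hKJ, hJI, hJ, hlen⟩ := exists_isIntegrallyClosedIdeal_length_eq_one hI hK hlt
    have h1 := length_quotient_eq_add_one hJI.le hlen
    have h2 := hlenle J hKJ
    rw [h1] at h2
    obtain ⟨i, hi⟩ := ENat.ne_top_iff_exists.mp (ne_top_of_le_ne_top hfin (hlenle I hle))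
    rw [← hi, ← hk] at h2 hn
    norm_cast at h2 hn
    omega
  | succ n ih =>
    intro I hI hle hn
    rcases hle.eq_or_lt with rfl | hlt
    · exact le_rfl
    obtain ⟨J, hKJ, hJI, hJ, hlen⟩ := exists_isIntegrallyClosedIdeal_length_eq_one hI hK hlt
    have h1 := length_quotient_eq_add_one hJI.le hlen
    have h2 := ih J hJ hKJ (by rw [h1, add_assoc, add_comm 1]; exact_mod_cast hn)
    have h3 := length_quotient_smul_add_finrank_le (M := M) hJ hJI
    have h4 : (Module.finrank R M : ℕ∞) ≠ ⊤ := ENat.natCast_ne_top _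
    rw [h1, mul_add, mul_one, ← add_assoc] at h2
    refine (ENat.add_le_add_iff_right h4).mp (le_trans ?_ h2)
    rw [add_right_comm]
    gcongr

/-! ### Growth of colengths -/

section Length

variable {R : Type*} [CommRing R]

theorem length_quotient_anti {J K : Ideal R} (h : J ≤ K) :
    Module.length R (R ⧸ K) ≤ Module.length R (R ⧸ J) :=
  Module.length_le_of_surjective (Submodule.factor h) (Submodule.factor_surjective _)

/-- Additivity of colength along multiplication by an element. -/
theorem length_quotient_eq_colon_add (J : Ideal R) (x : R) :
    Module.length R (R ⧸ J) =
      Module.length R (R ⧸ (Submodule.comap (LinearMap.mulRight R x) J : Ideal R)) +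
        Module.length R (R ⧸ (J ⊔ Ideal.span {x})) := by
  refine Module.length_eq_add_of_exact
    (Submodule.mapQ (Submodule.comap (LinearMap.mulRight R x) J) J (LinearMap.mulRight R x) le_rfl)
    (Submodule.mapQ J (J ⊔ Ideal.span {x}) LinearMap.id (by simp)) ?_ ?_ ?_
  · rw [← LinearMap.ker_eq_bot, Submodule.mapQ, Submodule.ker_liftQ_eq_bot]
    rw [LinearMap.ker_comp, Submodule.ker_mkQ]
  · rw [← LinearMap.range_eq_top, Submodule.range_mapQ]
    simp
  · rw [LinearMap.exact_iff, Submodule.ker_mapQ, Submodule.range_mapQ, Submodule.comap_id,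
      Submodule.map_sup, Submodule.mkQ_map_self, bot_sup_eq]
    congr 1
    ext y
    simp [Ideal.mem_span_singleton', LinearMap.mem_range]

theorem length_quotient_le_add {J A : Ideal R} (x : R) (h : ∀ a ∈ A, a * x ∈ J) :
    Module.length R (R ⧸ J) ≤
      Module.length R (R ⧸ A) + Module.length R (R ⧸ (J ⊔ Ideal.span {x})) := by
  rw [length_quotient_eq_colon_add J x]
  gcongr
  exact length_quotient_anti h

/-- Filter by powers of `y`: each of the `n` successive quotients is cyclic and killed by `J + (y)`.
-/
theorem length_quotient_sup_span_pow_le (J : Ideal R) (y : R) (n : ℕ) :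
    Module.length R (R ⧸ (J ⊔ Ideal.span {y ^ n})) ≤
      n * Module.length R (R ⧸ (J ⊔ Ideal.span {y})) := by
  induction n with
  | zero =>
    have : J ⊔ Ideal.span {y ^ 0} = ⊤ := by simp
    rw [Nat.cast_zero, zero_mul, nonpos_iff_eq_zero, Module.length_eq_zero_iff]
    exact Ideal.Quotient.subsingleton_iff.mpr this
  | succ n ih =>
    have hpow : y ^ (n + 1) ∈ Ideal.span {y ^ n} :=
      Ideal.mem_span_singleton.mpr (pow_dvd_pow y n.le_succ)
    have h1 := length_quotient_le_add (J := J ⊔ Ideal.span {y ^ (n + 1)})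
      (A := J ⊔ Ideal.span {y}) (y ^ n) (by
        intro a ha
        obtain ⟨j, hj, z, hz, rfl⟩ := Submodule.mem_sup.mp ha
        obtain ⟨c, rfl⟩ := Ideal.mem_span_singleton'.mp hz
        rw [add_mul]
        refine add_mem (Ideal.mem_sup_left (J.mul_mem_right _ hj)) (Ideal.mem_sup_right ?_)
        exact Ideal.mem_span_singleton'.mpr ⟨c, by ring⟩)
    have h2 : J ⊔ Ideal.span {y ^ (n + 1)} ⊔ Ideal.span {y ^ n} = J ⊔ Ideal.span {y ^ n} := by
      rw [sup_assoc, sup_eq_right.mpr ((Ideal.span_singleton_le_iff_mem _).mpr hpow)]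
    rw [h2] at h1
    refine h1.trans ?_
    rw [Nat.cast_add, Nat.cast_one, add_mul, one_mul, add_comm]
    gcongr

theorem length_quotient_sup_span_image_pow_le (s : Finset R) (J : Ideal R) (n : ℕ) :
    Module.length R (R ⧸ (J ⊔ Ideal.span ((· ^ n) '' (s : Set R)))) ≤
      n ^ s.card * Module.length R (R ⧸ (J ⊔ Ideal.span (s : Set R))) := by
  classical
  induction s using Finset.induction_on generalizing J with
  | empty => rw [Finset.coe_empty, Set.image_empty, Finset.card_empty, pow_zero, one_mul]
  | insert a s ha ih =>
    rw [Finset.card_insert_of_notMem ha, Finset.coe_insert, Set.image_insert_eq, Ideal.span_insert,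
      Ideal.span_insert, ← sup_assoc, ← sup_assoc]
    have h := length_quotient_sup_span_pow_le (J ⊔ Ideal.span (s : Set R)) a n
    rw [sup_right_comm, sup_right_comm J (Ideal.span (s : Set R)) (Ideal.span {a})] at h
    refine (ih _).trans ?_
    rw [pow_succ, mul_assoc]
    exact mul_le_mul_right h _

end Length

/-! ### Upper bounds from systems of parameters -/

theorem length_quotient_ne_top {R : Type*} [CommRing R] [IsNoetherianRing R] [IsLocalRing R]
    {J : Ideal R} (hJ : IsLocalRing.maximalIdeal R ≤ J.radical) :
    Module.length R (R ⧸ J) ≠ ⊤ := by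
  by_cases h : J = ⊤
  · have : Module.length R (R ⧸ J) = 0 := by
      rw [Module.length_eq_zero_iff]
      exact Ideal.Quotient.subsingleton_iff.mpr h
    simp [this]
  have : IsArtinianRing (R ⧸ J) := by
    refine IsLocalRing.quotient_artinian_of_mem_minimalPrimes_of_isLocalRing J
      ⟨⟨inferInstance, IsLocalRing.le_maximalIdeal h⟩, fun P hP _ => ?_⟩
    exact hJ.trans (hP.1.radical_le_iff.mpr hP.2)
  rw [Module.length_eq_of_surjective (R := R ⧸ J) Ideal.Quotient.mk_surjective]
  exact Module.length_ne_top

/-- Existence of a system of parameters modulo `J`. -/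
theorem exists_finset_maximalIdeal_le_radical {R : Type*} [CommRing R] [IsNoetherianRing R]
    [IsLocalRing R] {J : Ideal R} {n : ℕ} (hJ : J ≠ ⊤) (hn : ringKrullDim (R ⧸ J) ≤ n) :
    ∃ s : Finset R, s.card ≤ n ∧ (s : Set R) ⊆ IsLocalRing.maximalIdeal R ∧
      IsLocalRing.maximalIdeal R ≤ (J ⊔ Ideal.span (s : Set R)).radical := by
  classical
  have : Nontrivial (R ⧸ J) := Ideal.Quotient.nontrivial_iff.mpr hJ
  have : IsLocalRing (R ⧸ J) := .of_surjective' _ Ideal.Quotient.mk_surjective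
  obtain ⟨t, ht, hcard⟩ :=
    (IsLocalRing.maximalIdeal (R ⧸ J)).exists_finset_card_eq_height_of_isNoetherianRing
  choose g hg using (Ideal.Quotient.mk_surjective (I := J))
  refine ⟨t.image g, Finset.card_image_le.trans ?_, ?_, ?_⟩
  · rw [← IsLocalRing.maximalIdeal_height_eq_ringKrullDim, ← hcard] at hn
    exact_mod_cast hn
  · intro x hx
    obtain ⟨y, hy, rfl⟩ := Finset.mem_image.mp hx
    refine (IsLocalRing.mem_maximalIdeal _).mpr fun hu => ?_
    have h1 : y ∈ IsLocalRing.maximalIdeal (R ⧸ J) := ht.1.2 (Ideal.subset_span hy)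
    rw [← hg y] at h1
    exact h1 (hu.map _)
  · rw [Ideal.radical_eq_sInf]
    refine le_sInf fun P ⟨hP, hPp⟩ => ?_
    have hJP : J ≤ P := le_sup_left.trans hP
    have hmapP : (P.map (Ideal.Quotient.mk J)).IsPrime :=
      Ideal.map_isPrime_of_surjective Ideal.Quotient.mk_surjective (by simpa using hJP)
    have hle : Ideal.span (t : Set (R ⧸ J)) ≤ P.map (Ideal.Quotient.mk J) := by
      refine Ideal.span_le.mpr fun y hy => ?_
      rw [← hg y]
      exact Ideal.mem_map_of_mem _ (hP (Ideal.mem_sup_right (Ideal.subset_span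
        (Finset.mem_coe.mpr (Finset.mem_image_of_mem g hy)))))
    have h2 := ht.2 ⟨hmapP, hle⟩ (IsLocalRing.le_maximalIdeal hmapP.ne_top)
    intro x hx
    have h3 : Ideal.Quotient.mk J x ∈ P.map (Ideal.Quotient.mk J) := h2 (by
      rw [IsLocalRing.mem_maximalIdeal, mem_nonunits_iff]
      intro hu
      have : IsLocalHom (Ideal.Quotient.mk J) :=
        IsLocalHom.of_surjective _ Ideal.Quotient.mk_surjective
      exact (IsLocalRing.mem_maximalIdeal x).mp hx (isUnit_of_map_unit _ _ hu))
    have h4 := Ideal.mem_comap.mpr h3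
    rwa [Ideal.comap_map_mk hJP] at h4

theorem IsMaximalPrimary.exists_pow_le {R : Type*} [CommRing R] [IsNoetherianRing R]
    [IsLocalRing R] {I : Ideal R} (hI : IsMaximalPrimary I) :
    ∃ n, IsLocalRing.maximalIdeal R ^ n ≤ I := by
  rw [← show I.radical = IsLocalRing.maximalIdeal R from hI]
  exact I.exists_radical_pow_le_of_fg (IsNoetherian.noetherian _)

theorem IsMaximalPrimary.ne_top {R : Type*} [CommRing R] [IsLocalRing R] {I : Ideal R}
    (hI : IsMaximalPrimary I) : I ≠ ⊤ := by
  rintro rfl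
  exact (IsLocalRing.maximalIdeal.isMaximal R).ne_top (by rw [← hI, Ideal.radical_top])

/-- Frobenius powers of a primary ideal grow at most like the dimension. -/
theorem exists_length_quotient_frobeniusPower_le {R : Type*} [CommRing R] [IsNoetherianRing R]
    [IsLocalRing R] {I J : Ideal R} (hI : IsMaximalPrimary I) {n : ℕ}
    (hn : ringKrullDim (R ⧸ J) ≤ n) :
    ∃ C : ℕ, ∀ q : ℕ, 1 ≤ q →
      Module.length R (R ⧸ (J ⊔ frobeniusPower I q)) ≤ (C * q ^ n : ℕ) := by
  by_cases hJ : J = ⊤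
  · refine ⟨0, fun q _ => ?_⟩
    rw [hJ, top_sup_eq, Module.length_eq_zero_iff.mpr
      (Ideal.Quotient.subsingleton_iff.mpr rfl)]
    simp
  obtain ⟨s, hs, hsm, hrad⟩ := exists_finset_maximalIdeal_le_radical hJ hn
  obtain ⟨N, hN⟩ := hI.exists_pow_le
  obtain ⟨k, hk⟩ := ENat.ne_top_iff_exists.mp (length_quotient_ne_top hrad)
  refine ⟨N ^ s.card * k, fun q hq => ?_⟩
  -- Since `m^N ⊆ I`, the element `y^{Nq} = (y^N)^q` is a generator of `I^{[q]}`.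
  have hle : Ideal.span ((· ^ (N * q)) '' (s : Set R)) ≤ frobeniusPower I q := by
    refine Ideal.span_le.mpr ?_
    rintro _ ⟨y, hy, rfl⟩
    change y ^ (N * q) ∈ _
    rw [pow_mul]
    exact Ideal.subset_span ⟨y ^ N, hN (Ideal.pow_mem_pow (hsm hy) N), rfl⟩
  refine (length_quotient_anti (sup_le_sup_left hle J)).trans
    ((length_quotient_sup_span_image_pow_le s J (N * q)).trans ?_)
  rw [← hk]
  norm_cast
  calc (N * q) ^ s.card * k = N ^ s.card * k * q ^ s.card := by ring
    _ ≤ _ := by gcongr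

/-! ### Lower bounds from chains of primes -/

theorem pow_succ_le_pow_succ_add {s t k : ℕ} (h₁ : s ≤ t) (h₂ : t ≤ s + k) (n : ℕ) :
    t ^ (n + 1) ≤ s ^ (n + 1) + (n + 1) * k * t ^ n := by
  induction n with
  | zero => simpa using h₂
  | succ n ih =>
    calc t ^ (n + 2) = t * t ^ (n + 1) := by ring
      _ ≤ t * (s ^ (n + 1) + (n + 1) * k * t ^ n) := by gcongr
      _ = t * s ^ (n + 1) + (n + 1) * k * t ^ (n + 1) := by ring
      _ ≤ (s + k) * s ^ (n + 1) + (n + 1) * k * t ^ (n + 1) := by gcongr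
      _ = s ^ (n + 2) + k * s ^ (n + 1) + (n + 1) * k * t ^ (n + 1) := by ring
      _ ≤ s ^ (n + 2) + k * t ^ (n + 1) + (n + 1) * k * t ^ (n + 1) := by gcongr
      _ = _ := by ring

/-- Artin-Rees for the submodule of `R/P` generated by `x`, followed by cancelling `x`, which is a
nonzerodivisor modulo `P`. -/
theorem exists_mem_sup_pow_of_mul_mem {R : Type*} [CommRing R] [IsNoetherianRing R] (m : Ideal R)
    {P : Ideal R} [hP : P.IsPrime] {x : R} (hx : x ∉ P) :
    ∃ k : ℕ, ∀ t a, a * x ∈ P ⊔ m ^ t → a ∈ P ⊔ m ^ (t - k) := by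
  obtain ⟨k, hk⟩ := m.exists_pow_inf_eq_pow_smul (Submodule.span R {Ideal.Quotient.mk P x})
  refine ⟨k, fun t a ha => ?_⟩
  rcases lt_or_ge t k with h | h
  · simp [Nat.sub_eq_zero_of_le h.le]
  have key : ∀ (J : Ideal R) (b : R), Ideal.Quotient.mk P b ∈ J • (⊤ : Submodule R (R ⧸ P)) ↔
      b ∈ P ⊔ J := by
    intro J b
    have : J • (⊤ : Submodule R (R ⧸ P)) = Submodule.map P.mkQ J := by
      rw [← P.range_mkQ, ← Submodule.map_top, ← Submodule.map_smul'', smul_eq_mul, Ideal.mul_top]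
    rw [this, ← Submodule.comap_map_mkQ]
    rfl
  have h1 : Ideal.Quotient.mk P (a * x) ∈
      m ^ t • (⊤ : Submodule R (R ⧸ P)) ⊓ Submodule.span R {Ideal.Quotient.mk P x} :=
    ⟨(key _ _).mpr ha, Submodule.mem_span_singleton.mpr ⟨a, rfl⟩⟩
  rw [hk t h] at h1
  have h2 := Submodule.smul_mono (le_refl (m ^ (t - k))) inf_le_right h1
  obtain ⟨b, hb, hbx⟩ := Submodule.mem_smul_span_singleton.mp h2
  have h3 : (b - a) * x ∈ P := by
    rw [← Ideal.Quotient.eq_zero_iff_mem, sub_mul, map_sub, sub_eq_zero, ← hbx]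
    rfl
  have h4 := (hP.mem_or_mem h3).resolve_right hx
  rw [← sub_sub_cancel b a]
  exact sub_mem (Ideal.mem_sup_right hb) (Ideal.mem_sup_left h4)

/-- Colengths of powers of the maximal ideal grow at least like the length of a chain of primes. -/
theorem exists_pow_length_le_length_quotient_pow {R : Type*} [CommRing R] [IsNoetherianRing R]
    [IsLocalRing R] (l : LTSeries (PrimeSpectrum R)) :
    ∃ C : ℕ, ∀ t : ℕ, 1 ≤ t → ((t ^ l.length : ℕ) : ℕ∞) ≤
      C * Module.length R (R ⧸ (l.head.asIdeal ⊔ IsLocalRing.maximalIdeal R ^ t)) := by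
  induction l using RelSeries.inductionOn with
  | singleton P =>
    refine ⟨1, fun t ht => ?_⟩
    rw [RelSeries.singleton_length, pow_zero, Nat.cast_one, one_mul, Order.one_le_iff_pos,
      Module.length_pos_iff, Ideal.Quotient.nontrivial_iff]
    refine ne_top_of_le_ne_top (IsLocalRing.maximalIdeal.isMaximal R).ne_top (sup_le ?_ ?_)
    · exact IsLocalRing.le_maximalIdeal P.2.ne_top
    · exact Ideal.pow_le_self (by omega)
  | cons l P hPl ih =>
    obtain ⟨C, hC⟩ := ih
    set m := IsLocalRing.maximalIdeal R
    set n := l.length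
    have hlt : P.asIdeal < l.head.asIdeal := hPl
    obtain ⟨x, hxQ, hxP⟩ := SetLike.exists_of_lt hlt
    obtain ⟨k, hk, hk1⟩ : ∃ k : ℕ, (∀ t a, a * x ∈ P.asIdeal ⊔ m ^ t →
        a ∈ P.asIdeal ⊔ m ^ (t - k)) ∧ 1 ≤ k := by
      obtain ⟨k, hk⟩ := exists_mem_sup_pow_of_mul_mem m hxP
      -- The Artin-Rees constant is enlarged to be positive, so that the recursion from `t` to `t -
      -- k` terminates.
      exact ⟨k + 1, fun t a ha => (sup_le_sup_left (Ideal.pow_le_pow_right (by omega)) _ :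
        P.asIdeal ⊔ m ^ (t - k) ≤ P.asIdeal ⊔ m ^ (t - (k + 1))) (hk t a ha), by omega⟩
    -- Multiplication by `x` shows that passing from `t - k` to `t` raises the colength by at least
    -- that of `Q + m^t`, where `Q` is the old head; this is of order `t^n`, and summing gives order
    -- `t^{n+1}`.
    have hrec : ∀ t : ℕ, 1 ≤ t →
        ((n + 1) * k * C : ℕ) * Module.length R (R ⧸ (P.asIdeal ⊔ m ^ (t - k))) +
          ((n + 1) * k * t ^ n : ℕ) ≤
        ((n + 1) * k * C : ℕ) * Module.length R (R ⧸ (P.asIdeal ⊔ m ^ t)) := by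
      intro t ht
      rw [length_quotient_eq_colon_add (P.asIdeal ⊔ m ^ t) x, mul_add]
      refine add_le_add (mul_le_mul_right (length_quotient_anti fun a ha => hk t a ha) _) ?_
      rw [Nat.cast_mul ((n + 1) * k), Nat.cast_mul ((n + 1) * k), mul_assoc]
      refine mul_le_mul_right ((hC t ht).trans (mul_le_mul_right (length_quotient_anti ?_) _)) _
      exact sup_le (sup_le_sup_right hlt.le _)
        ((Ideal.span_singleton_le_iff_mem _).mpr (Ideal.mem_sup_left hxQ))
    refine ⟨(n + 1) * k * C, fun t _ => ?_⟩
    rw [RelSeries.cons_length, RelSeries.head_cons]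
    induction t using Nat.strong_induction_on with
    | _ t iht =>
      rcases Nat.eq_zero_or_pos t with rfl | ht
      · simp
      refine le_trans ?_ (hrec t ht)
      calc ((t ^ (n + 1) : ℕ) : ℕ∞) ≤ ((t - k) ^ (n + 1) + (n + 1) * k * t ^ n : ℕ) := by
            exact_mod_cast pow_succ_le_pow_succ_add (Nat.sub_le t k) (by omega) n
        _ ≤ _ := by
            rw [Nat.cast_add]
            refine add_le_add ?_ le_rfl
            rcases Nat.eq_zero_or_pos (t - k) with h0 | h0
            · simp [h0]
            · exact iht (t - k) (by omega) h0

theorem ringKrullDim_eq_krullDimNat (R : Type u) [CommRing R] [IsNoetherianRing R]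
    [IsLocalRing R] : ringKrullDim R = krullDimNat R := by
  have h := IsLocalRing.maximalIdeal_height_eq_ringKrullDim (R := R)
  obtain ⟨k, hk⟩ := ENat.ne_top_iff_exists.mp
    (Ideal.height_ne_top (IsLocalRing.maximalIdeal.isMaximal R).ne_top)
  rw [← hk] at h
  rw [krullDimNat, ← h]
  rfl

theorem exists_pow_krullDimNat_le_length_quotient_pow (R : Type u) [CommRing R]
    [IsNoetherianRing R] [IsLocalRing R] :
    ∃ C : ℕ, ∀ t : ℕ, 1 ≤ t → ((t ^ krullDimNat R : ℕ) : ℕ∞) ≤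
      C * Module.length R (R ⧸ IsLocalRing.maximalIdeal R ^ t) := by
  obtain ⟨l, hl⟩ := Order.le_krullDim_iff.mp (ringKrullDim_eq_krullDimNat R).ge
  obtain ⟨C, hC⟩ := exists_pow_length_le_length_quotient_pow l
  refine ⟨C, fun t ht => ?_⟩
  rw [← hl]
  exact (hC t ht).trans (mul_le_mul_right (length_quotient_anti le_sup_right) _)

/-! ### Comparison of a module with a free module -/

section Comparison

variable {R : Type*} [CommRing R]

theorem length_le_card_mul_of_annihilator {Q : Type*} [AddCommGroup Q] [Module R Q] {s : Finset Q}
    (hs : Submodule.span R (s : Set Q) = ⊤) {K : Ideal R} (hK : ∀ a ∈ K, ∀ x : Q, a • x = 0) :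
    Module.length R Q ≤ s.card * Module.length R (R ⧸ K) := by
  have htors : Module.IsTorsionBySet R Q K := fun x a => hK a a.2 x
  let := htors.module
  have : IsScalarTower R (R ⧸ K) Q := htors.isScalarTower
  have hsurj : Function.Surjective (algebraMap R (R ⧸ K)) := Ideal.Quotient.mk_surjective
  rw [Module.length_eq_of_surjective (R := R ⧸ K) (M := Q) hsurj,
    Module.length_eq_of_surjective (R := R ⧸ K) (M := R ⧸ K) hsurj]
  have h1 : Module.length (R ⧸ K) (s → R ⧸ K) = s.card * Module.length (R ⧸ K) (R ⧸ K) := by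
    rw [Module.length_pi, ENat.card_eq_coe_fintype_card, Fintype.card_coe]
  rw [← h1]
  refine Module.length_le_of_surjective
    (Fintype.linearCombination (R ⧸ K) (Subtype.val : s → Q)) ?_
  rw [← LinearMap.range_eq_top, Fintype.range_linearCombination, eq_top_iff,
    ← Submodule.restrictScalars_le R]
  refine le_trans (le_of_eq ?_) (Submodule.span_le_restrictScalars R (R ⧸ K) _)
  rw [Subtype.range_coe, hs]
  rfl

/-- Split `B/JB` along the image of `f`: the image is a quotient of `A/JA`, and the cokernel is
generated by `s` and killed by both `c` and `J`. -/
theorem length_quotient_smul_le_add {A B : Type*} [AddCommGroup A] [Module R A] [AddCommGroup B]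
    [Module R B] (f : A →ₗ[R] B) {c : R} (hc : ∀ b, c • b ∈ LinearMap.range f) {s : Finset B}
    (hs : Submodule.span R (s : Set B) = ⊤) (J : Ideal R) :
    Module.length R (B ⧸ J • (⊤ : Submodule R B)) ≤
      Module.length R (A ⧸ J • (⊤ : Submodule R A)) +
        s.card * Module.length R (R ⧸ (Ideal.span {c} ⊔ J)) := by
  classical
  set N₁ := J • (⊤ : Submodule R B)
  set N₂ := N₁ ⊔ LinearMap.range f
  rw [length_quotient_eq_add (le_sup_left : N₁ ≤ N₂)]
  refine add_le_add ?_ ?_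
  · have hker : J • (⊤ : Submodule R A) ≤ LinearMap.ker (N₁.mkQ ∘ₗ f) := by
      rw [LinearMap.ker_comp, Submodule.ker_mkQ, ← Submodule.map_le_iff_le_comap,
        Submodule.map_smul'']
      exact Submodule.smul_mono le_rfl le_top
    have hr : N₂.map N₁.mkQ = LinearMap.range ((J • (⊤ : Submodule R A)).liftQ _ hker) := by
      rw [Submodule.range_liftQ, LinearMap.range_comp, Submodule.map_sup, Submodule.mkQ_map_self,
        bot_sup_eq]
    rw [hr]
    exact Module.length_le_of_surjective _ (LinearMap.surjective_rangeRestrict _)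
  · have hspan : Submodule.span R ((s.image N₂.mkQ : Finset (B ⧸ N₂)) : Set (B ⧸ N₂)) = ⊤ := by
      rw [Finset.coe_image, ← Submodule.map_span, hs, Submodule.map_top, Submodule.range_mkQ]
    refine (length_le_card_mul_of_annihilator hspan (K := Ideal.span {c} ⊔ J) ?_).trans ?_
    · intro a ha x
      obtain ⟨b, rfl⟩ := N₂.mkQ_surjective x
      obtain ⟨y, hy, z, hz, rfl⟩ := Submodule.mem_sup.mp ha
      obtain ⟨w, rfl⟩ := Ideal.mem_span_singleton'.mp hy
      rw [← map_smul, Submodule.mkQ_apply, Submodule.Quotient.mk_eq_zero, add_smul]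
      refine add_mem (Submodule.mem_sup_right ?_) (Submodule.mem_sup_left ?_)
      · rw [mul_smul]
        exact Submodule.smul_mem _ _ (hc b)
      · exact Submodule.smul_mem_smul hz trivial
    · gcongr
      exact Finset.card_image_le

theorem length_pi_quotient_smul (n : ℕ) (J : Ideal R) :
    Module.length R ((Fin n → R) ⧸ J • (⊤ : Submodule R (Fin n → R))) =
      n * Module.length R (R ⧸ J) := by
  classical
  let φ : (Fin n → R) →ₗ[R] (Fin n → R ⧸ J) := LinearMap.pi fun i => J.mkQ ∘ₗ LinearMap.proj i
  have hφ : Function.Surjective φ := fun y => by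
    choose g hg using J.mkQ_surjective
    exact ⟨fun i => g (y i), funext fun i => hg (y i)⟩
  have hker : J • (⊤ : Submodule R (Fin n → R)) = LinearMap.ker φ := by
    refine le_antisymm (Submodule.smul_le.mpr fun a ha x _ => ?_) fun x hx => ?_
    · refine LinearMap.mem_ker.mpr (funext fun i => ?_)
      exact Ideal.Quotient.eq_zero_iff_mem.mpr (J.mul_mem_right _ ha)
    · rw [pi_eq_sum_univ x]
      refine Submodule.sum_mem _ fun i _ => Submodule.smul_mem_smul ?_ trivial
      exact Ideal.Quotient.eq_zero_iff_mem.mp (congrFun (LinearMap.mem_ker.mp hx) i)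
  rw [hker, (φ.quotKerEquivOfSurjective hφ).length_eq, Module.length_pi, ENat.card_eq_coe_fintype_card,
    Fintype.card_fin]

/-- A maximal independent family embeds `R^r` in `M` with torsion cokernel. A product `c` of nonzero
multipliers, one per generator, kills the cokernel, and `g` is `x ↦ f⁻¹(cx)`. -/
theorem exists_linearMap_comp_eq_smul [IsDomain R] (M : Type*) [AddCommGroup M] [Module R M]
    [Module.Finite R M] : ∃ c : R, c ≠ 0 ∧
      ∃ (f : (Fin (Module.finrank R M) → R) →ₗ[R] M) (g : M →ₗ[R] (Fin (Module.finrank R M) → R)),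
        (∀ x, f (g x) = c • x) ∧ ∀ y, g (f y) = c • y := by
  classical
  set r := Module.finrank R M
  obtain ⟨v, hv⟩ : ∃ v : Fin r → M, LinearIndependent R v :=
    exists_linearIndependent_of_le_finrank le_rfl
  set f : (Fin r → R) →ₗ[R] M := Fintype.linearCombination R v
  have hf : Function.Injective f := hv.fintypeLinearCombination_injective
  have hrank : Module.finrank R (M ⧸ LinearMap.range f) = 0 := by
    have h1 := Submodule.finrank_quotient_add_finrank (LinearMap.range f)
    rw [LinearMap.finrank_range_of_inj hf, Module.finrank_fin_fun] at h1
    omega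
  obtain ⟨c, hc0, hc⟩ : ∃ c : R, c ≠ 0 ∧ ∀ x : M, c • x ∈ LinearMap.range f := by
    rw [Module.finrank_eq_zero_iff] at hrank
    obtain ⟨s, hs⟩ := Module.Finite.fg_top (R := R) (M := M)
    choose a ha0 ha using fun x : M => hrank ((LinearMap.range f).mkQ x)
    refine ⟨∏ x ∈ s, a x, Finset.prod_ne_zero_iff.mpr fun x _ => ha0 x, fun x => ?_⟩
    have hx : x ∈ Submodule.span R (s : Set M) := hs ▸ trivial
    induction hx using Submodule.span_induction with
    | mem x hx =>
      rw [← Finset.prod_erase_mul s _ hx, mul_smul]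
      refine Submodule.smul_mem _ _ ?_
      have := ha x
      rwa [← map_smul, Submodule.mkQ_apply, Submodule.Quotient.mk_eq_zero] at this
    | zero => simp
    | add x y _ _ hx hy => rw [smul_add]; exact add_mem hx hy
    | smul b x _ hx => rw [smul_comm]; exact Submodule.smul_mem _ _ hx
  let e := LinearEquiv.ofInjective f hf
  let g : M →ₗ[R] (Fin r → R) :=
    e.symm.toLinearMap ∘ₗ (LinearMap.lsmul R M c).codRestrict (LinearMap.range f) hc
  have hfg : ∀ x, f (g x) = c • x := fun x => by
    have : f (g x) = (e (g x) : M) := rfl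
    rw [this]
    simp only [g, LinearMap.comp_apply, LinearEquiv.coe_coe, LinearEquiv.apply_symm_apply]
    rfl
  refine ⟨c, hc0, f, g, hfg, fun y => hf ?_⟩
  rw [hfg, map_smul]

end Comparison

/-! ### Asymptotics of Frobenius powers -/

theorem length_quotient_smul_ne_top {R : Type*} [CommRing R] {M : Type*} [AddCommGroup M]
    [Module R M] [Module.Finite R M] {J : Ideal R}
    (hJ : Module.length R (R ⧸ J) ≠ ⊤) :
    Module.length R (M ⧸ J • (⊤ : Submodule R M)) ≠ ⊤ := by
  obtain ⟨s, hs⟩ := Module.Finite.fg_top (R := R) (M := M ⧸ J • (⊤ : Submodule R M))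
  refine ne_top_of_le_ne_top ?_ (length_le_card_mul_of_annihilator hs (K := J) fun a ha x => ?_)
  · obtain ⟨l, hl⟩ := ENat.ne_top_iff_exists.mp hJ
    rw [← hl, ← Nat.cast_mul]
    exact ENat.natCast_ne_top _
  · obtain ⟨m, rfl⟩ := Submodule.mkQ_surjective _ x
    rw [← map_smul, Submodule.mkQ_apply, Submodule.Quotient.mk_eq_zero]
    exact Submodule.smul_mem_smul ha trivial

section Asymptotics

variable {R : Type u} [CommRing R] [IsNoetherianRing R] [IsLocalRing R]

theorem exists_length_quotient_frobeniusPower_le_pow {I : Ideal R} (hI : IsMaximalPrimary I) :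
    ∃ C : ℕ, ∀ q : ℕ, 1 ≤ q →
      Module.length R (R ⧸ frobeniusPower I q) ≤ (C * q ^ krullDimNat R : ℕ) := by
  obtain ⟨C, hC⟩ := exists_length_quotient_frobeniusPower_le (J := ⊥) hI (n := krullDimNat R)
    ((ringKrullDim_quotient_le _).trans (ringKrullDim_eq_krullDimNat R).le)
  exact ⟨C, fun q hq => (length_quotient_anti (bot_sup_eq _).le).trans (hC q hq)⟩

theorem length_quotient_frobeniusPower_ne_top {I : Ideal R} (hI : IsMaximalPrimary I) {q : ℕ}
    (hq : 1 ≤ q) : Module.length R (R ⧸ frobeniusPower I q) ≠ ⊤ := by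
  obtain ⟨C, hC⟩ := exists_length_quotient_frobeniusPower_le_pow hI
  exact ne_top_of_le_ne_top (ENat.natCast_ne_top _) (hC q hq)

/-- `R/(c)` has dimension `d - 1`. The factor `q` on the left avoids a truncated exponent `d - 1`.
-/
theorem exists_length_quotient_span_sup_frobeniusPower_mul_le [IsDomain R] {I : Ideal R}
    (hI : IsMaximalPrimary I) {c : R} (hc : c ≠ 0) :
    ∃ C : ℕ, ∀ q : ℕ, 1 ≤ q →
      Module.length R (R ⧸ (Ideal.span {c} ⊔ frobeniusPower I q)) * q ≤
        (C * q ^ krullDimNat R : ℕ) := by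
  by_cases hu : IsUnit c
  · refine ⟨0, fun q _ => ?_⟩
    rw [Ideal.span_singleton_eq_top.mpr hu, top_sup_eq, Module.length_eq_zero_iff.mpr
      (Ideal.Quotient.subsingleton_iff.mpr rfl)]
    simp
  have hdim := ringKrullDim_quotient_span_singleton_succ_eq_ringKrullDim_of_mem_nonZeroDivisors
    (mem_nonZeroDivisors_of_ne_zero hc) ((IsLocalRing.mem_maximalIdeal c).mpr hu)
  rw [ringKrullDim_eq_krullDimNat R] at hdim
  have : Nontrivial (R ⧸ Ideal.span {c}) := Ideal.Quotient.nontrivial_iff.mpr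
    (by rwa [ne_eq, Ideal.span_singleton_eq_top])
  have : IsLocalRing (R ⧸ Ideal.span {c}) := .of_surjective' _ Ideal.Quotient.mk_surjective
  rw [ringKrullDim_eq_krullDimNat] at hdim
  have hd : krullDimNat (R ⧸ Ideal.span {c}) + 1 = krullDimNat R := by exact_mod_cast hdim
  obtain ⟨C, hC⟩ := exists_length_quotient_frobeniusPower_le hI
    (ringKrullDim_eq_krullDimNat (R ⧸ Ideal.span {c})).le
  refine ⟨C, fun q hq => ?_⟩
  rw [← hd, pow_succ, ← mul_assoc, Nat.cast_mul]
  gcongr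
  exact hC q hq

/-- Up to an error of lower order, a finite module behaves like a free module of the same rank. -/
theorem exists_abs_length_quotient_smul_sub_le [IsDomain R] (M : Type*) [AddCommGroup M]
    [Module R M] [Module.Finite R M] {I : Ideal R} (hI : IsMaximalPrimary I) :
    ∃ C : ℝ, ∀ q : ℕ, 1 ≤ q →
      |((Module.length R (M ⧸ frobeniusPower I q • (⊤ : Submodule R M))).toNat : ℝ) -
        Module.finrank R M * colength (frobeniusPower I q)| ≤ C * q ^ krullDimNat R / q := by
  classical
  obtain ⟨c, hc0, f, g, hfg, hgf⟩ := exists_linearMap_comp_eq_smul (R := R) M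
  obtain ⟨s, hs⟩ := Module.Finite.fg_top (R := R) (M := M)
  obtain ⟨t, ht⟩ := Module.Finite.fg_top (R := R) (M := Fin (Module.finrank R M) → R)
  obtain ⟨C, hC⟩ := exists_length_quotient_span_sup_frobeniusPower_mul_le hI hc0
  refine ⟨(s.card + t.card : ℕ) * C, fun q hq => ?_⟩
  have h1 := length_quotient_smul_le_add f (c := c) (fun b => ⟨g b, hfg b⟩) hs (frobeniusPower I q)
  have h2 := length_quotient_smul_le_add g (c := c) (fun b => ⟨f b, hgf b⟩) ht (frobeniusPower I q)
  rw [length_pi_quotient_smul] at h1 h2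
  have h3 := hC q hq
  have hq0 := length_quotient_frobeniusPower_ne_top hI hq
  have ha := length_quotient_smul_ne_top (M := M) hq0
  have hb : Module.length R (R ⧸ (Ideal.span {c} ⊔ frobeniusPower I q)) ≠ ⊤ :=
    ne_top_of_le_ne_top hq0 (length_quotient_anti le_sup_right)
  rw [colength]
  obtain ⟨l, hl⟩ := ENat.ne_top_iff_exists.mp hq0
  obtain ⟨a, ha⟩ := ENat.ne_top_iff_exists.mp ha
  obtain ⟨b, hb⟩ := ENat.ne_top_iff_exists.mp hb
  rw [← hl, ← ha, ← hb] at h1 h2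
  rw [← hb] at h3
  rw [← hl, ← ha, ENat.toNat_natCast, ENat.toNat_natCast]
  norm_cast at h1 h2 h3
  have hqpos : (0 : ℝ) < q := by exact_mod_cast hq
  have h3' : (b : ℝ) ≤ C * q ^ krullDimNat R / q := by
    rw [le_div_iff₀ hqpos]
    exact_mod_cast h3
  have h1' : (a : ℝ) ≤ Module.finrank R M * l + s.card * b := by exact_mod_cast h1
  have h2' : (Module.finrank R M * l : ℝ) ≤ a + t.card * b := by exact_mod_cast h2
  have hb0 : (0 : ℝ) ≤ b := b.cast_nonneg
  have h4 : ((s.card + t.card : ℕ) : ℝ) * b ≤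
      (s.card + t.card : ℕ) * C * q ^ krullDimNat R / q := by
    rw [mul_assoc, mul_div_assoc]
    gcongr
  push_cast at h4 ⊢
  have hs0 : (0 : ℝ) ≤ s.card * b := by positivity
  have ht0 : (0 : ℝ) ≤ t.card * b := by positivity
  rw [abs_le]
  constructor <;> linarith

end Asymptotics

/-! ### Frobenius pushforwards -/

/-- The ring `R`, regarded as an `R`-algebra by the `e`-th iterate of the Frobenius. -/
@[nolint unusedArguments]
def FrobeniusPushforward (R : Type u) (_p _e : ℕ) : Type u := R

namespace FrobeniusPushforward

variable (R : Type u) [CommRing R] (p e : ℕ)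

instance : CommRing (FrobeniusPushforward R p e) := inferInstanceAs (CommRing R)

instance [IsLocalRing R] : IsLocalRing (FrobeniusPushforward R p e) :=
  inferInstanceAs (IsLocalRing R)

instance [ExpChar R p] : Algebra R (FrobeniusPushforward R p e) := (iterateFrobenius R p e).toAlgebra

/-- The identity as a ring isomorphism to the pushforward. -/
def of : R ≃+* FrobeniusPushforward R p e := RingEquiv.refl R

variable {R p e}

theorem algebraMap_apply [ExpChar R p] (x : R) :
    algebraMap R (FrobeniusPushforward R p e) x = of R p e (x ^ p ^ e) := rfl

end FrobeniusPushforward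

/-- `A` surjects onto the residue field of `B`, so simple `B`-modules remain simple over `A`. In the
infinite case, restriction of scalars can only increase length. -/
theorem length_eq_length_restrictScalars {A B : Type*} [CommRing A] [CommRing B] [IsLocalRing B]
    [Algebra A B] (h : ∀ b : B, ∃ a : A, b - algebraMap A B a ∈ IsLocalRing.maximalIdeal B)
    {M : Type*} [AddCommGroup M] [Module A M] [Module B M] [IsScalarTower A B M] :
    Module.length A M = Module.length B M := by
  by_cases hM : IsFiniteLength B M
  · revert ‹IsScalarTower A B M›
    revert ‹Module A M›
    induction hM with
    | of_subsingleton => intros; simp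
    | @of_simple_quotient M _ _ N hs hN ih =>
      intro _ _
      have : IsSimpleModule A (M ⧸ N) := by
        have hs' := isSimpleModule_iff_toSpanSingleton_surjective.mp hs
        rw [isSimpleModule_iff_toSpanSingleton_surjective]
        refine ⟨hs'.1, fun x hx y => ?_⟩
        obtain ⟨b, rfl⟩ := hs'.2 x hx y
        obtain ⟨a, ha⟩ := h b
        refine ⟨a, ?_⟩
        rw [← IsLocalRing.eq_maximalIdeal (IsSimpleModule.annihilator_isMaximal (M := M ⧸ N)),
          Module.mem_annihilator] at ha
        have hax := ha x
        rw [sub_smul, sub_eq_zero, algebraMap_smul] at hax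
        exact hax.symm
      rw [Module.length_eq_add_of_exact N.subtype N.mkQ N.injective_subtype N.mkQ_surjective
          (LinearMap.exact_subtype_mkQ N), Module.length_eq_add_of_exact
          (N.subtype.restrictScalars A) (N.mkQ.restrictScalars A) N.injective_subtype
          N.mkQ_surjective (LinearMap.exact_subtype_mkQ N), ih, Module.length_eq_one B (M ⧸ N),
          Module.length_eq_one A (M ⧸ N)]
  · rw [← Module.length_ne_top_iff, not_not] at hM
    rw [hM, ← top_le_iff, ← hM, ← Module.length_top (R := B)]
    refine (Submodule.length_le_length_restrictScalars A _).trans ?_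
    rw [Submodule.restrictScalars_top, Module.length_top]

section Frobenius

variable {R : Type u} [CommRing R] {p : ℕ} [ExpChar R p]

theorem frobeniusPower_eq_map (I : Ideal R) (e : ℕ) :
    frobeniusPower I (p ^ e) = I.map (iterateFrobenius R p e) := rfl

theorem frobeniusPower_frobeniusPower (I : Ideal R) (a b : ℕ) :
    frobeniusPower (frobeniusPower I (p ^ a)) (p ^ b) = frobeniusPower I (p ^ (a + b)) := by
  rw [frobeniusPower_eq_map, frobeniusPower_eq_map, frobeniusPower_eq_map, Ideal.map_map,
    add_comm, iterateFrobenius_add]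

namespace FrobeniusPushforward

theorem finite_of_frobenius (h : (frobenius R p).Finite) (e : ℕ) :
    Module.Finite R (FrobeniusPushforward R p e) := by
  have : (iterateFrobenius R p e).Finite := by
    induction e with
    | zero => rw [iterateFrobenius_zero]; exact RingHom.Finite.id R
    | succ e ih =>
      rw [iterateFrobenius_add, iterateFrobenius_one]
      exact ih.comp h
  exact this

/-- Elements of the residue field have `p^e`-th roots, so lengths over the source and target of
Frobenius agree, while `I` extends along Frobenius to its Frobenius power. -/
theorem length_quotient_smul [IsLocalRing R] [IsAlgClosed (IsLocalRing.ResidueField R)]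
    (hp : 0 < p) (e : ℕ) (I : Ideal R) :
    Module.length R (FrobeniusPushforward R p e ⧸
        I • (⊤ : Submodule R (FrobeniusPushforward R p e))) =
      Module.length R (R ⧸ frobeniusPower I (p ^ e)) := by
  set F := FrobeniusPushforward R p e
  have h : ∀ b : F, ∃ a : R, b - algebraMap R F a ∈ IsLocalRing.maximalIdeal F := by
    intro b
    obtain ⟨z, hz⟩ := IsAlgClosed.exists_pow_nat_eq
      (IsLocalRing.residue R ((of R p e).symm b)) (pow_pos hp e)
    obtain ⟨a, rfl⟩ := IsLocalRing.residue_surjective z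
    refine ⟨a, ?_⟩
    have : (of R p e).symm b - a ^ p ^ e ∈ IsLocalRing.maximalIdeal R := by
      rw [← IsLocalRing.residue_eq_zero_iff, map_sub, map_pow, hz, sub_self]
    exact this
  rw [Ideal.smul_top_eq_map, ((Submodule.Quotient.restrictScalarsEquiv R _).length_eq),
    length_eq_length_restrictScalars h]
  rfl

end FrobeniusPushforward

end Frobenius

/-! ### Asymptotically geometric sequences -/

theorem not_bddAbove_of_forall_add_le {x : ℕ → ℝ} {δ : ℝ} (hδ : 0 < δ)
    (h : ∀ᶠ e in atTop, x e + δ ≤ x (e + 1)) (B : ℝ) : ∃ e, B < x e := by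
  obtain ⟨N, hN⟩ := eventually_atTop.mp h
  have hx : ∀ n : ℕ, x N + n * δ ≤ x (N + n) := fun n => by
    induction n with
    | zero => simp
    | succ n ih =>
      have := hN (N + n) (by omega)
      push_cast
      rw [← add_assoc]
      linarith
  obtain ⟨n, hn⟩ := exists_nat_gt ((B - x N) / δ)
  refine ⟨N + n, ?_⟩
  rw [div_lt_iff₀ hδ] at hn
  linarith [hx n]

/-- A bounded sequence, bounded away from zero, which is asymptotically geometric has ratio one. -/
theorem eq_one_of_tendsto_sub_mul {x : ℕ → ℝ} {c B ρ : ℝ} (hc : 0 < c) (hcx : ∀ e, c ≤ x e)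
    (hB : ∀ e, x e ≤ B) (h : Tendsto (fun e => x (e + 1) - ρ * x e) atTop (𝓝 0)) : ρ = 1 := by
  rcases lt_trichotomy ρ 1 with hρ | hρ | hρ
  · exfalso
    -- A ratio `ρ < 1` makes `x` drop by at least `(1 - ρ)c` up to the error; half is kept once the
    -- error is below the other half.
    have hδ : 0 < (1 - ρ) * c / 2 := by have := sub_pos.mpr hρ; positivity
    obtain ⟨e, he⟩ := not_bddAbove_of_forall_add_le (x := fun e => -x e) hδ (by
      filter_upwards [h.eventually_lt_const hδ] with e he
      nlinarith [mul_le_mul_of_nonneg_left (hcx e) (sub_pos.mpr hρ).le]) 0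
    linarith [hcx e]
  · exact hρ
  · exfalso
    have hδ : 0 < (ρ - 1) * c / 2 := by have := sub_pos.mpr hρ; positivity
    obtain ⟨e, he⟩ := not_bddAbove_of_forall_add_le (x := x) hδ (by
      filter_upwards [h.eventually_const_lt (neg_neg_of_pos hδ)] with e he
      nlinarith [mul_le_mul_of_nonneg_left (hcx e) (sub_pos.mpr hρ).le]) B
    linarith [hB e]

theorem tendsto_const_mul_half_pow (C : ℝ) :
    Tendsto (fun e : ℕ => C * (1 / 2 : ℝ) ^ e) atTop (𝓝 0) := by
  simpa using (tendsto_pow_atTop_nhds_zero_of_lt_one (by norm_num) (by norm_num :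
    (1 / 2 : ℝ) < 1)).const_mul C

theorem isMaximalPrimary_maximalIdeal {R : Type*} [CommRing R] [IsLocalRing R] :
    IsMaximalPrimary (IsLocalRing.maximalIdeal R) :=
  (IsLocalRing.maximalIdeal.isMaximal R).isPrime.radical

/-! ### Existence of the limit and the rank of the pushforwards -/

section Existence

variable {R : Type u} [CommRing R] [IsNoetherianRing R] [IsLocalRing R] {p : ℕ}
  [hp : Fact p.Prime]

theorem exists_hkSeq_le {I : Ideal R} (hI : IsMaximalPrimary I) : ∃ B, ∀ e, hkSeq p I e ≤ B := by
  obtain ⟨C, hC⟩ := exists_length_quotient_frobeniusPower_le_pow hI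
  refine ⟨C, fun e => ?_⟩
  have hp0 : (0 : ℝ) < p := by exact_mod_cast hp.out.pos
  rw [hkSeq, div_le_iff₀ (by positivity), colength]
  have h := hC (p ^ e) (Nat.one_le_pow _ _ hp.out.pos)
  have h1 := ENat.toNat_le_toNat h (ENat.natCast_ne_top _)
  rw [ENat.toNat_natCast] at h1
  exact_mod_cast h1

/-- `m^{[q]} ⊆ m^q`, and the colength of `m^q` is at least of order `q^d`. -/
theorem exists_pos_le_hkSeq_maximalIdeal :
    ∃ c > 0, ∀ e, c ≤ hkSeq p (IsLocalRing.maximalIdeal R) e := by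
  obtain ⟨C, hC⟩ := exists_pow_krullDimNat_le_length_quotient_pow R
  have hp0 : (0 : ℝ) < p := by exact_mod_cast hp.out.pos
  have key : ∀ e, ((p : ℝ) ^ e) ^ krullDimNat R ≤
      C * colength (frobeniusPower (IsLocalRing.maximalIdeal R) (p ^ e)) := fun e => by
    have h1 := hC (p ^ e) (Nat.one_le_pow _ _ hp.out.pos)
    have h2 : frobeniusPower (IsLocalRing.maximalIdeal R) (p ^ e) ≤
        IsLocalRing.maximalIdeal R ^ p ^ e := by
      refine Ideal.span_le.mpr ?_
      rintro _ ⟨x, hx, rfl⟩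
      exact Ideal.pow_mem_pow hx _
    have h3 := h1.trans (mul_le_mul_right (length_quotient_anti h2) _)
    obtain ⟨l, hl⟩ := ENat.ne_top_iff_exists.mp (length_quotient_frobeniusPower_ne_top
      (isMaximalPrimary_maximalIdeal (R := R)) (Nat.one_le_pow e _ hp.out.pos))
    rw [colength, ← hl, ENat.toNat_natCast]
    rw [← hl] at h3
    exact_mod_cast h3
  have hC0 : (0 : ℝ) < C := by
    have h := key 0
    rcases Nat.eq_zero_or_pos C with h0 | h0
    · simp [h0] at h
      linarith
    · exact_mod_cast h0
  refine ⟨1 / C, by positivity, fun e => ?_⟩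
  rw [hkSeq, div_le_div_iff₀ hC0 (by positivity), one_mul, mul_comm]
  exact key e

variable [IsDomain R] [CharP R p] [IsAlgClosed (IsLocalRing.ResidueField R)]

/-- Comparison of the `a`-th pushforward with a free module, along `I^{[p^e]}`. The relative error
is of order `p^{-e}`, at most `2^{-e}` up to a constant. -/
theorem exists_abs_hkSeq_sub_le (hF : (frobenius R p).Finite) {I : Ideal R}
    (hI : IsMaximalPrimary I) (a : ℕ) :
    ∃ C : ℝ, ∀ e, |hkSeq p I (e + a) - Module.finrank R (FrobeniusPushforward R p a) /
      ((p : ℝ) ^ a) ^ krullDimNat R * hkSeq p I e| ≤ C * (1 / 2) ^ e := by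
  have := FrobeniusPushforward.finite_of_frobenius hF a
  obtain ⟨C, hC⟩ := exists_abs_length_quotient_smul_sub_le (FrobeniusPushforward R p a) hI
  have hC0 : 0 ≤ C := by
    have := (abs_nonneg _).trans (hC 1 le_rfl)
    simpa using this
  have hp0 : (0 : ℝ) < p := by exact_mod_cast hp.out.pos
  set d := krullDimNat R with hd
  refine ⟨C / ((p : ℝ) ^ a) ^ d, fun e => ?_⟩
  have h := hC (p ^ e) (Nat.one_le_pow _ _ hp.out.pos)
  rw [FrobeniusPushforward.length_quotient_smul hp.out.pos, frobeniusPower_frobeniusPower] at h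
  change |colength (frobeniusPower I (p ^ (e + a))) - _| ≤ _ at h
  have heq : hkSeq p I (e + a) - Module.finrank R (FrobeniusPushforward R p a) /
      ((p : ℝ) ^ a) ^ d * hkSeq p I e =
      (colength (frobeniusPower I (p ^ (e + a))) - Module.finrank R (FrobeniusPushforward R p a) *
        colength (frobeniusPower I (p ^ e))) / (((p : ℝ) ^ a) ^ d * ((p : ℝ) ^ e) ^ d) := by
    rw [hkSeq, hkSeq, ← hd, pow_add (p : ℝ) e a, mul_pow, mul_comm (((p : ℝ) ^ e) ^ d)]
    field_simp
  rw [heq, abs_div, abs_of_pos (by positivity : (0 : ℝ) < ((p : ℝ) ^ a) ^ d * ((p : ℝ) ^ e) ^ d),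
    div_le_iff₀ (by positivity)]
  refine h.trans ?_
  push_cast
  have h2 : 1 / (p : ℝ) ^ e ≤ (1 / 2) ^ e := by
    rw [one_div_pow]
    gcongr
    exact_mod_cast hp.out.two_le
  calc C * ((p : ℝ) ^ e) ^ d / (p : ℝ) ^ e = C * ((p : ℝ) ^ e) ^ d * (1 / (p : ℝ) ^ e) := by ring
    _ ≤ C * ((p : ℝ) ^ e) ^ d * (1 / 2) ^ e := by gcongr
    _ = _ := by field_simp

/-- The normalised colengths of `m` are bounded and bounded away from zero, so their asymptotic
ratio, which is this quotient, can only be one. -/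
theorem finrank_frobeniusPushforward_one_div_eq_one (hF : (frobenius R p).Finite) :
    (Module.finrank R (FrobeniusPushforward R p 1) : ℝ) / ((p : ℝ) ^ 1) ^ krullDimNat R = 1 := by
  obtain ⟨c, hc, hcx⟩ := exists_pos_le_hkSeq_maximalIdeal (R := R) (p := p)
  obtain ⟨B, hB⟩ := exists_hkSeq_le (p := p) (isMaximalPrimary_maximalIdeal (R := R))
  obtain ⟨C, hC⟩ := exists_abs_hkSeq_sub_le hF (isMaximalPrimary_maximalIdeal (R := R)) 1
  exact eq_one_of_tendsto_sub_mul hc hcx hB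
    (squeeze_zero_norm hC (tendsto_const_mul_half_pow C))

/-- Existence of the Hilbert-Kunz multiplicity. -/
theorem tendsto_hkSeq (hF : (frobenius R p).Finite) {I : Ideal R} (hI : IsMaximalPrimary I) :
    Tendsto (hkSeq p I) atTop (𝓝 (hkMultiplicity p I)) := by
  obtain ⟨C, hC⟩ := exists_abs_hkSeq_sub_le hF hI 1
  have hcau : CauchySeq (hkSeq p I) := by
    refine cauchySeq_of_le_geometric (1 / 2) C (by norm_num) fun e => ?_
    have := hC e
    rw [finrank_frobeniusPushforward_one_div_eq_one hF, one_mul] at this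
    rwa [dist_comm, Real.dist_eq]
  exact hcau.tendsto_limUnder

theorem finrank_frobeniusPushforward (hF : (frobenius R p).Finite) (a : ℕ) :
    (Module.finrank R (FrobeniusPushforward R p a) : ℝ) = ((p : ℝ) ^ a) ^ krullDimNat R := by
  obtain ⟨c, hc, hcx⟩ := exists_pos_le_hkSeq_maximalIdeal (R := R) (p := p)
  have hlim := tendsto_hkSeq hF (isMaximalPrimary_maximalIdeal (R := R))
  obtain ⟨C, hC⟩ := exists_abs_hkSeq_sub_le hF (isMaximalPrimary_maximalIdeal (R := R)) a
  have h0 : Tendsto (fun e => hkSeq p (IsLocalRing.maximalIdeal R) (e + a) -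
      Module.finrank R (FrobeniusPushforward R p a) / ((p : ℝ) ^ a) ^ krullDimNat R *
        hkSeq p (IsLocalRing.maximalIdeal R) e) atTop (𝓝 0) :=
    squeeze_zero_norm hC (tendsto_const_mul_half_pow C)
  have h1 := ((tendsto_add_atTop_iff_nat a).mpr hlim).sub (hlim.const_mul
    (Module.finrank R (FrobeniusPushforward R p a) / ((p : ℝ) ^ a) ^ krullDimNat R))
  -- With `ρ` the normalised rank, the two limits give `(1 - ρ) e_HK(R) = 0`, and `e_HK(R) > 0`.
  have h2 := tendsto_nhds_unique h1 h0
  have hpos : 0 < hkMultiplicity p (IsLocalRing.maximalIdeal R) :=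
    hc.trans_le (ge_of_tendsto' hlim hcx)
  have hp0 : (0 : ℝ) < p := by exact_mod_cast hp.out.pos
  have h3 : (Module.finrank R (FrobeniusPushforward R p a) : ℝ) /
      ((p : ℝ) ^ a) ^ krullDimNat R = 1 := by
    apply mul_right_cancel₀ hpos.ne'
    linarith
  exact (div_eq_one_iff_eq (by positivity)).mp h3

end Existence

/-! ### Inequalities between Hilbert-Kunz multiplicity and colength -/

section Inequalities

theorem IsMaximalPrimary.colength_ne_top {R : Type*} [CommRing R] [IsNoetherianRing R]
    [IsLocalRing R] {I : Ideal R} (hI : IsMaximalPrimary I) : Module.length R (R ⧸ I) ≠ ⊤ :=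
  length_quotient_ne_top (le_of_eq hI.symm)

theorem IsMaximalPrimary.le_maximalIdeal {R : Type*} [CommRing R] [IsLocalRing R] {I : Ideal R}
    (hI : IsMaximalPrimary I) : I ≤ IsLocalRing.maximalIdeal R :=
  IsLocalRing.le_maximalIdeal hI.ne_top

theorem colength_maximalIdeal {R : Type*} [CommRing R] [IsLocalRing R] :
    Module.length R (R ⧸ IsLocalRing.maximalIdeal R) = 1 := by
  rw [Module.length_eq_one_iff]
  exact isSimpleModule_iff_isCoatom.mpr (IsLocalRing.maximalIdeal.isMaximal R).out

variable {R : Type u} [CommRing R] [IsNoetherianRing R] [IsLocalRing R] [IsDomain R] {p : ℕ}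
  [hp : Fact p.Prime] [CharP R p] [IsAlgClosed (IsLocalRing.ResidueField R)]

theorem hkSeq_maximalIdeal_add_colength_le (hF : (frobenius R p).Finite) {I : Ideal R}
    (hI : IsMaximalPrimary I) (hIc : IsIntegrallyClosedIdeal I) (e : ℕ) :
    hkSeq p (IsLocalRing.maximalIdeal R) e + colength I ≤ hkSeq p I e + 1 := by
  have := FrobeniusPushforward.finite_of_frobenius hF e
  have h := length_quotient_smul_le_of_isIntegrallyClosedIdeal (M := FrobeniusPushforward R p e)
    (isIntegrallyClosedIdeal_of_isPrime (IsLocalRing.maximalIdeal R)) hIc hI.le_maximalIdeal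
    hI.colength_ne_top
  rw [FrobeniusPushforward.length_quotient_smul hp.out.pos,
    FrobeniusPushforward.length_quotient_smul hp.out.pos, colength_maximalIdeal, mul_one] at h
  have hq := Nat.one_le_pow e p hp.out.pos
  have hp0 : (0 : ℝ) < p := by exact_mod_cast hp.out.pos
  have hr := finrank_frobeniusPushforward hF e
  obtain ⟨a, ha⟩ := ENat.ne_top_iff_exists.mp
    (length_quotient_frobeniusPower_ne_top (isMaximalPrimary_maximalIdeal (R := R)) hq)
  obtain ⟨b, hb⟩ := ENat.ne_top_iff_exists.mp (length_quotient_frobeniusPower_ne_top hI hq)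
  obtain ⟨l, hl⟩ := ENat.ne_top_iff_exists.mp hI.colength_ne_top
  rw [← ha, ← hb, ← hl] at h
  rw [hkSeq, hkSeq, colength, colength, colength, ← ha, ← hb, ← hl, ENat.toNat_natCast,
    ENat.toNat_natCast, ENat.toNat_natCast]
  have h' : (a : ℝ) + Module.finrank R (FrobeniusPushforward R p e) * l ≤
      b + Module.finrank R (FrobeniusPushforward R p e) := by exact_mod_cast h
  rw [hr] at h'
  have hpos : 0 < ((p : ℝ) ^ e) ^ krullDimNat R := by positivity
  rw [div_add' _ _ _ hpos.ne', div_add_one hpos.ne', div_le_div_iff_of_pos_right hpos]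
  linarith

theorem colength_add_hkMultiplicity_sub_one_le (hF : (frobenius R p).Finite) {I : Ideal R}
    (hI : IsMaximalPrimary I) (hIc : IsIntegrallyClosedIdeal I) :
    colength I + hkMultiplicity p (IsLocalRing.maximalIdeal R) - 1 ≤ hkMultiplicity p I := by
  have h := le_of_tendsto_of_tendsto'
    ((tendsto_hkSeq hF (isMaximalPrimary_maximalIdeal (R := R))).add_const (colength I))
    ((tendsto_hkSeq hF hI).add_const 1) (hkSeq_maximalIdeal_add_colength_le hF hI hIc)
  linarith

theorem maximalIdeal_mul_le_of_length_eq_one {R : Type*} [CommRing R] [IsLocalRing R]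
    {I K : Ideal R} (h : Module.length R (I ⧸ K.submoduleOf I) = 1) :
    IsLocalRing.maximalIdeal R * I ≤ K := by
  rw [Module.length_eq_one_iff] at h
  refine Ideal.mul_le.mpr fun a ha x hx => ?_
  rw [← IsLocalRing.eq_maximalIdeal (IsSimpleModule.annihilator_isMaximal (R := R)
    (M := I ⧸ K.submoduleOf I)), Module.mem_annihilator] at ha
  have h1 := ha ((K.submoduleOf I).mkQ ⟨x, hx⟩)
  rw [← map_smul, Submodule.mkQ_apply, Submodule.Quotient.mk_eq_zero] at h1
  exact h1

theorem exists_le_sup_span_of_length_eq_one {R : Type*} [CommRing R]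
    {I K : Ideal R} (hKI : K ≤ I) (h : Module.length R (I ⧸ K.submoduleOf I) = 1) :
    ∃ x ∈ I, I = K ⊔ Ideal.span {x} := by
  rw [Module.length_eq_one_iff] at h
  have := IsSimpleModule.nontrivial R (I ⧸ K.submoduleOf I)
  obtain ⟨y, hy⟩ := exists_ne (0 : I ⧸ K.submoduleOf I)
  obtain ⟨x, rfl⟩ := (K.submoduleOf I).mkQ_surjective y
  refine ⟨x, x.2, le_antisymm (fun z hz => ?_)
    (sup_le hKI ((Ideal.span_singleton_le_iff_mem _).mpr x.2))⟩
  obtain ⟨a, ha⟩ := (isSimpleModule_iff_toSpanSingleton_surjective.mp h).2 _ hy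
    ((K.submoduleOf I).mkQ ⟨z, hz⟩)
  rw [LinearMap.toSpanSingleton_apply, ← map_smul, ← sub_eq_zero, ← map_sub, Submodule.mkQ_apply,
    Submodule.Quotient.mk_eq_zero] at ha
  have ha' : a * (x : R) - z ∈ K := ha
  rw [← sub_sub_cancel (a * (x : R)) z]
  exact sub_mem (Ideal.mem_sup_right (Ideal.mul_mem_left _ _ (Ideal.mem_span_singleton_self _)))
    (Ideal.mem_sup_left ha')

theorem isMaximalPrimary_of_length_eq_one {R : Type*} [CommRing R] [IsLocalRing R] {I K : Ideal R}
    (hI : IsMaximalPrimary I) (hKI : K ≤ I) (h : Module.length R (I ⧸ K.submoduleOf I) = 1) :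
    IsMaximalPrimary K := by
  refine le_antisymm ((Ideal.radical_mono hKI).trans (le_of_eq hI)) ?_
  have h1 := Ideal.radical_mono (maximalIdeal_mul_le_of_length_eq_one h)
  rwa [Ideal.radical_mul, show I.radical = IsLocalRing.maximalIdeal R from hI,
    (IsLocalRing.maximalIdeal.isMaximal R).isPrime.radical, inf_idem] at h1

/-- From `I = K + (x)` and `mI ⊆ K`, Frobenius gives `I^{[q]} = K^{[q]} + (x^q)` and `m^{[q]} x^q ⊆
K^{[q]}`. -/
theorem hkSeq_le_add_of_length_eq_one {R : Type u} [CommRing R] [IsNoetherianRing R]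
    [IsLocalRing R] {p : ℕ} [hp : Fact p.Prime] [CharP R p] {I K : Ideal R}
    (hI : IsMaximalPrimary I) (hKI : K ≤ I) (h : Module.length R (I ⧸ K.submoduleOf I) = 1)
    (e : ℕ) : hkSeq p K e ≤ hkSeq p (IsLocalRing.maximalIdeal R) e + hkSeq p I e := by
  have hK := isMaximalPrimary_of_length_eq_one hI hKI h
  obtain ⟨x, hx, hIx⟩ := exists_le_sup_span_of_length_eq_one hKI h
  have hmul := maximalIdeal_mul_le_of_length_eq_one h
  have hsup : frobeniusPower K (p ^ e) ⊔ Ideal.span {x ^ p ^ e} = frobeniusPower I (p ^ e) := by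
    rw [frobeniusPower_eq_map, frobeniusPower_eq_map,
      congrArg (Ideal.map (iterateFrobenius R p e)) hIx, Ideal.map_sup, Ideal.map_span,
      Set.image_singleton, iterateFrobenius_def]
  have hcol : ∀ a ∈ frobeniusPower (IsLocalRing.maximalIdeal R) (p ^ e),
      a * x ^ p ^ e ∈ frobeniusPower K (p ^ e) := by
    intro a ha
    have h1 : frobeniusPower (IsLocalRing.maximalIdeal R) (p ^ e) * frobeniusPower I (p ^ e) ≤
        frobeniusPower K (p ^ e) := by
      rw [frobeniusPower_eq_map, frobeniusPower_eq_map, frobeniusPower_eq_map, ← Ideal.map_mul]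
      exact Ideal.map_mono hmul
    exact h1 (Ideal.mul_mem_mul ha (Ideal.subset_span ⟨x, hx, rfl⟩))
  have h2 := length_quotient_le_add (x ^ p ^ e) hcol
  rw [hsup] at h2
  have hq := Nat.one_le_pow e p hp.out.pos
  have hp0 : (0 : ℝ) < p := by exact_mod_cast hp.out.pos
  obtain ⟨a, ha⟩ := ENat.ne_top_iff_exists.mp
    (length_quotient_frobeniusPower_ne_top (isMaximalPrimary_maximalIdeal (R := R)) hq)
  obtain ⟨b, hb⟩ := ENat.ne_top_iff_exists.mp (length_quotient_frobeniusPower_ne_top hI hq)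
  obtain ⟨c, hc⟩ := ENat.ne_top_iff_exists.mp (length_quotient_frobeniusPower_ne_top hK hq)
  rw [← ha, ← hb, ← hc] at h2
  rw [hkSeq, hkSeq, hkSeq, colength, colength, colength, ← ha, ← hb, ← hc, ENat.toNat_natCast,
    ENat.toNat_natCast, ENat.toNat_natCast, ← add_div]
  gcongr
  exact_mod_cast h2

/-- Part (1) for `K` has colength one larger than that of `I`, which cancels the `-1`; the term
`e_HK(R)` cancels against subadditivity. -/
theorem colength_le_hkMultiplicity (hF : (frobenius R p).Finite) {I K : Ideal R}
    (hI : IsMaximalPrimary I) (hKI : K ≤ I) (hK : IsIntegrallyClosedIdeal K)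
    (h : Module.length R (I ⧸ K.submoduleOf I) = 1) :
    colength I ≤ hkMultiplicity p I := by
  have hKp := isMaximalPrimary_of_length_eq_one hI hKI h
  have h1 := colength_add_hkMultiplicity_sub_one_le hF hKp hK
  have h2 := le_of_tendsto_of_tendsto' (tendsto_hkSeq hF hKp)
    ((tendsto_hkSeq hF (isMaximalPrimary_maximalIdeal (R := R))).add (tendsto_hkSeq hF hI))
    (hkSeq_le_add_of_length_eq_one hI hKI h)
  have h3 : colength K = colength I + 1 := by
    rw [colength, colength, length_quotient_eq_add_one hKI h,
      ENat.toNat_add hI.colength_ne_top ENat.one_ne_top]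
    simp
  linarith

end Inequalities

/-! ### Regular rings are reduced -/

open IsLocalRing in
theorem exists_finset_maximalIdeal_eq_span_insert {R : Type u} [CommRing R] [IsLocalRing R]
    [IsNoetherianRing R] {n : ℕ} (hn : (maximalIdeal R).spanFinrank = n + 1) {x : R}
    (hx : x ∈ maximalIdeal R) (hx2 : x ∉ maximalIdeal R ^ 2) :
    ∃ y : Fin n → R, maximalIdeal R = Ideal.span (insert x (Set.range y)) := by
  rw [spanFinrank_maximalIdeal_eq_finrank_cotangentSpace] at hn
  set v : CotangentSpace R := (maximalIdeal R).toCotangent ⟨x, hx⟩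
  have hv : v ≠ 0 := by rwa [ne_eq, Ideal.toCotangent_eq_zero]
  have hquot : Module.finrank (ResidueField R)
      (CotangentSpace R ⧸ Submodule.span (ResidueField R) {v}) = n := by
    have := Submodule.finrank_quotient_add_finrank (Submodule.span (ResidueField R) {v})
    rw [finrank_span_singleton hv] at this
    omega
  let b := Module.finBasisOfFinrankEq _ _ hquot
  choose w hw using fun i => Submodule.mkQ_surjective _ (b i)
  choose y hy using fun i => (maximalIdeal R).toCotangent_surjective (w i)
  refine ⟨fun i => y i, ?_⟩
  have hspan : Submodule.span R (insert ⟨x, hx⟩ (Set.range y) : Set (maximalIdeal R)) = ⊤ := by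
    rw [← CotangentSpace.span_image_eq_top_iff, Set.image_insert_eq, ← Set.range_comp]
    have h1 : (maximalIdeal R).toCotangent ∘ y = w := funext hy
    rw [h1]
    have h2 : Submodule.map (Submodule.span (ResidueField R) {v}).mkQ
        (Submodule.span (ResidueField R) (insert v (Set.range w))) = ⊤ := by
      rw [Submodule.map_span, eq_top_iff, ← b.span_eq]
      refine Submodule.span_mono ?_
      rintro _ ⟨i, rfl⟩
      exact ⟨w i, Or.inr ⟨i, rfl⟩, hw i⟩
    have h3 := congrArg (Submodule.comap (Submodule.span (ResidueField R) {v}).mkQ) h2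
    rwa [Submodule.comap_map_mkQ, Submodule.comap_top, sup_eq_right.mpr
      (Submodule.span_mono (by simp))] at h3
  have h4 := congrArg (Submodule.map (maximalIdeal R).subtype) hspan
  rw [Submodule.map_span, Submodule.map_top, Submodule.range_subtype, Set.image_insert_eq,
    ← Set.range_comp] at h4
  exact h4.symm

open IsLocalRing in
theorem exists_mem_maximalIdeal_notMem_sq_notMem_minimalPrimes (R : Type u) [CommRing R]
    [IsRegularLocalRing R] (hn : (maximalIdeal R).spanFinrank ≠ 0) :
    ∃ x ∈ maximalIdeal R, x ∉ maximalIdeal R ^ 2 ∧ ∀ P ∈ minimalPrimes R, x ∉ P := by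
  by_contra! hcon
  have hfin := minimalPrimes.finite_of_isNoetherianRing R
  have hsub : (maximalIdeal R : Set R) ⊆ ⋃ I ∈ ((insert (maximalIdeal R ^ 2) hfin.toFinset :
      Finset (Ideal R)) : Set (Ideal R)), (I : Set R) := by
    intro x hx
    by_cases h2 : x ∈ maximalIdeal R ^ 2
    · exact Set.mem_biUnion (x := maximalIdeal R ^ 2) (by simp) h2
    · obtain ⟨P, hP, hxP⟩ := hcon x hx h2
      exact Set.mem_biUnion (x := P) (by simp [hP]) hxP
  -- Prime avoidance tolerates two non-prime ideals; `m^2` fills both places.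
  obtain ⟨I, hI, hle⟩ := (Ideal.subset_union_prime (f := id) (maximalIdeal R ^ 2)
    (maximalIdeal R ^ 2) (fun P hP hne _ => by
      have : P ∈ minimalPrimes R := by simpa [hne] using hP
      exact this.1.1)).mp hsub
  have hreg := IsRegularLocalRing.spanFinrank_maximalIdeal (R := R)
  rcases Finset.mem_insert.mp hI with rfl | hP
  · have hbot : maximalIdeal R ≤ ⊥ :=
      Submodule.le_of_le_smul_of_le_jacobson_bot (I := maximalIdeal R) (IsNoetherian.noetherian _)
        (maximalIdeal_le_jacobson _) (by simpa [pow_two] using hle)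
    rw [le_bot_iff.mp hbot] at hn
    simp at hn
  · have hPmin : I ∈ minimalPrimes R := by simpa using hP
    have : I.IsPrime := hPmin.1.1
    have hIm : I = maximalIdeal R := le_antisymm (le_maximalIdeal this.ne_top) hle
    have h0 : (maximalIdeal R).height = 0 := by
      rw [← hIm, Ideal.height_eq_zero_iff]
      exact hPmin
    rw [← maximalIdeal_height_eq_ringKrullDim, h0] at hreg
    exact hn (by exact_mod_cast hreg)

open IsLocalRing in
theorem isRegularLocalRing_quotient_span_singleton {R : Type u} [CommRing R] [IsRegularLocalRing R]
    {n : ℕ} (hn : (maximalIdeal R).spanFinrank = n + 1) {x : R}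
    (hx : x ∈ maximalIdeal R) (hx2 : x ∉ maximalIdeal R ^ 2) :
    ∃ _ : IsRegularLocalRing (R ⧸ Ideal.span {x}),
      (maximalIdeal (R ⧸ Ideal.span {x})).spanFinrank = n := by
  have hne : Ideal.span {x} ≠ ⊤ := fun h =>
    (maximalIdeal.isMaximal R).ne_top (top_le_iff.mp (h ▸ (Ideal.span_singleton_le_iff_mem _).mpr hx))
  have : Nontrivial (R ⧸ Ideal.span {x}) := Ideal.Quotient.nontrivial_iff.mpr hne
  have : IsLocalRing (R ⧸ Ideal.span {x}) := .of_surjective' _ Ideal.Quotient.mk_surjective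
  obtain ⟨y, hy⟩ := exists_finset_maximalIdeal_eq_span_insert hn hx hx2
  have hmax : maximalIdeal (R ⧸ Ideal.span {x}) =
      Ideal.span (Set.range fun i => Ideal.Quotient.mk (Ideal.span {x}) (y i)) := by
    have h1 : (maximalIdeal R).map (Ideal.Quotient.mk (Ideal.span {x})) =
        maximalIdeal (R ⧸ Ideal.span {x}) := by
      refine IsLocalRing.eq_maximalIdeal (Ideal.IsMaximal.map_of_surjective_of_ker_le
        Ideal.Quotient.mk_surjective ?_)
      rw [Ideal.mk_ker]
      exact (Ideal.span_singleton_le_iff_mem _).mpr hx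
    rw [← h1, hy, Ideal.map_span, Set.image_insert_eq, ← Set.range_comp, Ideal.span_insert,
      Ideal.Quotient.eq_zero_iff_mem.mpr (Ideal.mem_span_singleton_self x), Ideal.span_singleton_zero,
      bot_sup_eq]
    rfl
  have hle : (maximalIdeal (R ⧸ Ideal.span {x})).spanFinrank ≤ n := by
    rw [hmax]
    refine (Submodule.spanFinrank_span_le_ncard_of_finite (Set.finite_range _)).trans ?_
    rw [← Set.image_univ]
    refine (Set.ncard_image_le Set.finite_univ).trans ?_
    simp [Set.ncard_univ]
  have hdim : (n : WithBot ℕ∞) ≤ ringKrullDim (R ⧸ Ideal.span {x}) := by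
    have h1 := Ideal.height_le_ringKrullDim_quotient_add_one hx
    rw [maximalIdeal_height_eq_ringKrullDim, ← IsRegularLocalRing.spanFinrank_maximalIdeal, hn] at h1
    rw [ringKrullDim_eq_krullDimNat] at h1 ⊢
    have h2 : n + 1 ≤ krullDimNat (R ⧸ Ideal.span {x}) + 1 := by exact_mod_cast h1
    have h3 : n ≤ krullDimNat (R ⧸ Ideal.span {x}) := by omega
    exact_mod_cast h3
  have hreg : IsRegularLocalRing (R ⧸ Ideal.span {x}) :=
    .of_spanFinrank_maximalIdeal_le _ (le_trans (by exact_mod_cast hle) hdim)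
  refine ⟨hreg, le_antisymm hle ?_⟩
  have h := hreg.spanFinrank_maximalIdeal
  rw [← h] at hdim
  exact_mod_cast hdim

-- Induction on embedding dimension: for `x` outside `m^2` and all minimal primes, `R/(x)` is
-- regular, so `(x)` is prime. A minimal prime `P ⊆ (x)` not containing `x` satisfies `P = xP`,
-- hence vanishes by Nakayama.
open IsLocalRing in
theorem isDomain_of_isRegularLocalRing (R : Type u) [CommRing R] [IsRegularLocalRing R] :
    IsDomain R := by
  obtain ⟨n, hn⟩ : ∃ n, (maximalIdeal R).spanFinrank = n := ⟨_, rfl⟩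
  induction n generalizing R with
  | zero =>
    rw [Submodule.spanFinrank_eq_zero_iff_eq_bot (IsNoetherian.noetherian _)] at hn
    exact (isField_iff_maximalIdeal_eq.mpr hn).isDomain
  | succ n ih =>
    obtain ⟨x, hx, hx2, hxP⟩ := exists_mem_maximalIdeal_notMem_sq_notMem_minimalPrimes R
      (by omega)
    obtain ⟨hreg, hrank⟩ := isRegularLocalRing_quotient_span_singleton hn hx hx2
    have hdom := ih (R ⧸ Ideal.span {x}) hrank
    have hprime : (Ideal.span {x}).IsPrime := (Ideal.Quotient.isDomain_iff_prime _).mp hdom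
    obtain ⟨P, hP, hPx⟩ := Ideal.exists_minimalPrimes_le (I := ⊥) (J := Ideal.span {x}) bot_le
    have hPp : P.IsPrime := hP.1.1
    have hle : P ≤ ⊥ := by
      refine Submodule.le_of_le_smul_of_le_jacobson_bot (I := maximalIdeal R)
        (IsNoetherian.noetherian _) (maximalIdeal_le_jacobson _) fun z hz => ?_
      obtain ⟨a, rfl⟩ := Ideal.mem_span_singleton'.mp (hPx hz)
      rw [bot_sup_eq, mul_comm]
      exact Ideal.mul_mem_mul hx ((hPp.mem_or_mem hz).resolve_right (hxP P hP))
    rw [le_bot_iff.mp hle] at hPp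
    exact IsDomain.of_bot_isPrime R

theorem isReduced_of_isRegularRing (R : Type u) [CommRing R] [IsRegularRing R] : IsReduced R := by
  refine isReduced_ofLocalizationMaximal R fun J hJ => ?_
  have := isDomain_of_isRegularLocalRing (Localization.AtPrime J)
  infer_instance

/-! ### Finiteness of the Frobenius -/

/-! ### Geometric reducedness and `p`-th roots -/

section GenericFibre

variable {A : Type u} [CommRing A] {p : ℕ} [ExpChar A p]

/-- The `p`-th root embedding of the Frobenius pushforward into a perfect algebra. -/
noncomputable def FrobeniusPushforward.root (A : Type u) [CommRing A] (p : ℕ) [ExpChar A p]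
    (Ω : Type*) [CommRing Ω] [Algebra A Ω] [ExpChar Ω p] [PerfectRing Ω p] :
    FrobeniusPushforward A p 1 →ₗ[A] Ω where
  toFun x := (frobeniusEquiv Ω p).symm (algebraMap A Ω ((FrobeniusPushforward.of A p 1).symm x))
  map_add' x y := by simp only [map_add]
  map_smul' a x := by
    rw [Algebra.smul_def, map_mul, FrobeniusPushforward.algebraMap_apply, RingEquiv.symm_apply_apply,
      pow_one, map_mul, map_mul, map_pow, Algebra.smul_def, RingHom.id_apply]
    congr 1
    rw [RingEquiv.symm_apply_eq, frobeniusEquiv_apply, frobenius_def]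

theorem FrobeniusPushforward.root_pow (Ω : Type*) [CommRing Ω] [Algebra A Ω] [ExpChar Ω p]
    [PerfectRing Ω p] (x : FrobeniusPushforward A p 1) :
    FrobeniusPushforward.root A p Ω x ^ p =
      algebraMap A Ω ((FrobeniusPushforward.of A p 1).symm x) :=
  frobeniusEquiv_symm_pow_p _ _ _

theorem FrobeniusPushforward.root_injective (Ω : Type*) [CommRing Ω] [Algebra A Ω] [ExpChar Ω p]
    [PerfectRing Ω p] (h : Function.Injective (algebraMap A Ω)) :
    Function.Injective (FrobeniusPushforward.root A p Ω) := fun _ _ hxy =>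
  (FrobeniusPushforward.of A p 1).symm.injective
    (h ((frobeniusEquiv Ω p).symm.injective hxy))

/-- The `p`-th power of the sum is `1 ⊗ ∑ a_i b_i^p = 0`, and the ring is reduced. -/
theorem sum_tmul_eq_zero_of_isReduced (hp : p.Prime) {B : Type*} [CommRing B] [Algebra A B]
    {L : Type*} [CommRing L] [Algebra A L]
    [IsReduced (L ⊗[A] B)] {ι : Type*} (s : Finset ι) (a : ι → A) (t : ι → L)
    (ht : ∀ i, t i ^ p = algebraMap A L (a i)) (b : ι → B) (h : ∑ i ∈ s, a i • b i ^ p = 0) :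
    ∑ i ∈ s, t i ⊗ₜ[A] b i = 0 := by
  rcases subsingleton_or_nontrivial (L ⊗[A] B) with hs | hs
  · exact Subsingleton.elim _ _
  have : ExpChar (L ⊗[A] B) p := by
    have : CharP A p := by
      rcases ‹ExpChar A p› with _ | _
      · exact absurd hp Nat.not_prime_one
      · assumption
    have : CharP (L ⊗[A] B) p := by
      rw [CharP.charP_iff_prime_eq_zero hp]
      have h := congrArg (algebraMap A (L ⊗[A] B)) (CharP.cast_eq_zero A p)
      rwa [map_natCast, map_zero] at h
    exact .prime hp
  refine eq_zero_of_pow_eq_zero (n := p) ?_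
  have h1 := map_sum (frobenius (L ⊗[A] B) p) (fun i => t i ⊗ₜ[A] b i) s
  rw [frobenius_def] at h1
  rw [h1]
  have h2 := congrArg (fun x => (1 : L) ⊗ₜ[A] x) h
  simp only [TensorProduct.tmul_sum, TensorProduct.tmul_zero] at h2
  rw [← h2]
  refine Finset.sum_congr rfl fun i _ => ?_
  rw [frobenius_def, Algebra.TensorProduct.tmul_pow, ht, Algebra.algebraMap_eq_smul_one,
    TensorProduct.smul_tmul]

/-- Taking `p`-th roots embeds the pushforward of `A` in an algebraic closure of `K`, and flatness
of `B` preserves this. The finitely many roots involved lie in a finite extension `L`, where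
reducedness applies. -/
theorem sum_tmul_eq_zero_of_forall_isReduced (hp : p.Prime)
    {B : Type u} [CommRing B] [Algebra A B] [Module.Flat A B]
    {K : Type u} [Field K] [Algebra A K] (hAK : Function.Injective (algebraMap A K))
    (hred : ∀ (L : Type u) [Field L] [Algebra K L], Module.Finite K L →
      IsReduced (L ⊗[K] (K ⊗[A] B)))
    {ι : Type*} [Finite ι] (s : Finset ι) (a : ι → FrobeniusPushforward A p 1) (b : ι → B)
    (h : ∑ i ∈ s, (FrobeniusPushforward.of A p 1).symm (a i) • b i ^ p = 0) :
    ∑ i ∈ s, a i ⊗ₜ[A] b i = 0 := by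
  let Ω := AlgebraicClosure K
  have hAΩ : Function.Injective (algebraMap A Ω) := by
    rw [IsScalarTower.algebraMap_eq A K Ω]
    exact (algebraMap K Ω).injective.comp hAK
  have : ExpChar K p := expChar_of_injective_algebraMap hAK p
  have : ExpChar Ω p := expChar_of_injective_algebraMap hAΩ p
  let ψ := FrobeniusPushforward.root A p Ω
  refine Module.Flat.rTensor_preserves_injective_linearMap (M := B) ψ
    (FrobeniusPushforward.root_injective Ω hAΩ) ?_
  rw [map_zero, map_sum]
  simp only [LinearMap.rTensor_tmul]
  let L := IntermediateField.adjoin K (Set.range (ψ ∘ a))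
  have : FiniteDimensional K L := by
    have := (Set.finite_range (ψ ∘ a)).to_subtype
    exact IntermediateField.finiteDimensional_adjoin fun x _ =>
      (Algebra.IsAlgebraic.isAlgebraic x).isIntegral
  have hLred := hred L this
  have : IsReduced (L ⊗[A] B) := isReduced_of_injective
    (Algebra.TensorProduct.cancelBaseChange A K K L B).symm
    (Algebra.TensorProduct.cancelBaseChange A K K L B).symm.injective
  let t : ι → L := fun i => ⟨ψ (a i), IntermediateField.subset_adjoin _ _ ⟨i, rfl⟩⟩
  have ht : ∀ i, t i ^ p = algebraMap A L ((FrobeniusPushforward.of A p 1).symm (a i)) := fun i =>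
    Subtype.ext (FrobeniusPushforward.root_pow Ω (a i))
  have hz := congrArg (LinearMap.rTensor B ((L.val.restrictScalars A).toLinearMap))
    (sum_tmul_eq_zero_of_isReduced hp s _ t ht b h)
  rw [map_zero, map_sum] at hz
  exact hz

end GenericFibre

/-! ### Generators over a complete ring -/

theorem isPrecomplete_pi_fin {B : Type*} [CommRing B] (I : Ideal B) [IsPrecomplete I B] (r : ℕ) :
    IsPrecomplete I (Fin r → B) := by
  rw [← AdicCompletion.of_surjective_iff]
  intro x
  choose y hy using fun i => AdicCompletion.of_surjective I B (AdicCompletion.piEquivFin I r x i)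
  refine ⟨y, (AdicCompletion.piEquivFin I r).injective (funext fun i => ?_)⟩
  rw [← hy i]
  ext n
  rfl

theorem FrobeniusPushforward.isHausdorff {B : Type u} [CommRing B] {p : ℕ} [ExpChar B p]
    (I : Ideal B) [IsHausdorff I B] (e : ℕ) :
    IsHausdorff I (FrobeniusPushforward B p e) where
  haus' x hx := by
    refine IsHausdorff.haus ‹_› ((of B p e).symm x) fun n => ?_
    have h := hx n
    rw [SModEq.zero, Ideal.smul_top_eq_map] at h
    rw [SModEq.zero, smul_eq_mul, Ideal.mul_top]
    have hle : (I ^ n).map (algebraMap B (FrobeniusPushforward B p e)) ≤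
        (I ^ n).comap ((of B p e).symm : FrobeniusPushforward B p e →+* B) :=
      Ideal.map_le_iff_le_comap.mpr fun y hy =>
        Ideal.pow_mem_of_mem _ hy _ (pow_pos (expChar_pos B p) e)
    exact hle h

/-- Nakayama over a complete ring: the target need only be separated, so finiteness of the
pushforward is a conclusion and not an assumption. -/
theorem FrobeniusPushforward.exists_eq_sum_smul {B : Type u} [CommRing B] {p : ℕ} [ExpChar B p]
    (I : Ideal B) [IsAdicComplete I B] {e r : ℕ} (a : Fin r → FrobeniusPushforward B p e)
    (h : ∀ x : FrobeniusPushforward B p e, ∃ c : Fin r → B,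
      x - ∑ i, c i • a i ∈ I • (⊤ : Submodule B (FrobeniusPushforward B p e)))
    (x : FrobeniusPushforward B p e) : ∃ c : Fin r → B, ∑ i, c i • a i = x := by
  have := isPrecomplete_pi_fin I r
  have := FrobeniusPushforward.isHausdorff (p := p) I e
  refine surjective_of_mkQ_comp_surjective (I := I) (f := Fintype.linearCombination B a) ?_ x
  intro y
  obtain ⟨y, rfl⟩ := Submodule.mkQ_surjective _ y
  obtain ⟨c, hc⟩ := h y
  refine ⟨c, ?_⟩
  rw [eq_comm, LinearMap.comp_apply, ← sub_eq_zero, ← map_sub, Submodule.mkQ_apply,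
    Submodule.Quotient.mk_eq_zero]
  exact hc

/-! ### Frobenius on the completion -/

section Completion

open IsLocalRing

variable {A : Type u} [CommRing A] [IsLocalRing A] [IsNoetherianRing A]

theorem exists_sub_algebraMap_mem_map_pow (x : AdicCompletion (maximalIdeal A) A) (n : ℕ) :
    ∃ a : A, x - algebraMap A _ a ∈
      (maximalIdeal A ^ n).map (algebraMap A (AdicCompletion (maximalIdeal A) A)) := by
  obtain ⟨a, ha⟩ := Submodule.mkQ_surjective _ (AdicCompletion.eval (maximalIdeal A) A n x)
  refine ⟨a, ?_⟩
  have h : x - algebraMap A _ a ∈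
      (maximalIdeal A ^ n • ⊤ : Submodule A (AdicCompletion (maximalIdeal A) A)) := by
    rw [AdicCompletion.pow_smul_top_eq_ker_eval (maximalIdeal A).fg_of_isNoetherianRing,
      LinearMap.mem_ker, map_sub, sub_eq_zero, ← ha]
    rfl
  rwa [Ideal.smul_top_eq_map] at h

theorem exists_maximalIdeal_pow_le_frobeniusPower (q : ℕ) :
    ∃ n, maximalIdeal A ^ n ≤ frobeniusPower (maximalIdeal A) q := by
  refine Ideal.exists_pow_le_of_le_radical_of_fg (fun x hx => ⟨q, Ideal.subset_span ⟨x, hx, rfl⟩⟩)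
    (maximalIdeal A).fg_of_isNoetherianRing

variable {p : ℕ} [ExpChar A p]

/-- The quotient by `m` has the finite length of `A / m^{[p^e]}`, hence finitely many generators. -/
theorem FrobeniusPushforward.exists_fin_forall_sub_mem [IsAlgClosed (ResidueField A)] (e : ℕ) :
    ∃ (r : ℕ) (a : Fin r → FrobeniusPushforward A p e),
      ∀ x : FrobeniusPushforward A p e, ∃ c : Fin r → A, x - ∑ i, c i • a i ∈
        maximalIdeal A • (⊤ : Submodule A (FrobeniusPushforward A p e)) := by
  set F := FrobeniusPushforward A p e
  have hp : 0 < p := expChar_pos A p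
  have hlen : Module.length A (F ⧸ maximalIdeal A • (⊤ : Submodule A F)) ≠ ⊤ := by
    rw [length_quotient_smul hp]
    exact length_quotient_frobeniusPower_ne_top isMaximalPrimary_maximalIdeal
      (Nat.one_le_pow _ _ hp)
  have hfl := Module.length_ne_top_iff.mp hlen
  have := (isFiniteLength_iff_isNoetherian_isArtinian.mp hfl).1
  obtain ⟨r, a', ha'⟩ := Module.Finite.exists_fin (R := A)
    (M := F ⧸ maximalIdeal A • (⊤ : Submodule A F))
  choose a ha using fun i => Submodule.mkQ_surjective _ (a' i)
  refine ⟨r, a, fun x => ?_⟩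
  have hx : Submodule.mkQ _ x ∈ Submodule.span A (Set.range a') := ha' ▸ trivial
  obtain ⟨c, hc⟩ := (Submodule.mem_span_range_iff_exists_fun A).mp hx
  refine ⟨c, ?_⟩
  rw [← Submodule.Quotient.mk_eq_zero, ← Submodule.mkQ_apply, map_sub, map_sum, ← hc, sub_eq_zero]
  exact Finset.sum_congr rfl fun i _ => by rw [map_smul, ha]

theorem exists_completion_eq_sum [ExpChar (AdicCompletion (maximalIdeal A) A) p] {r : ℕ}
    (a : Fin r → FrobeniusPushforward A p 1)
    (h : ∀ x : FrobeniusPushforward A p 1, ∃ c : Fin r → A, x - ∑ i, c i • a i ∈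
        maximalIdeal A • (⊤ : Submodule A (FrobeniusPushforward A p 1)))
    (x : AdicCompletion (maximalIdeal A) A) :
    ∃ b : Fin r → AdicCompletion (maximalIdeal A) A,
      ∑ i, (FrobeniusPushforward.of A p 1).symm (a i) • b i ^ p = x := by
  let B := AdicCompletion (maximalIdeal A) A
  let φ : FrobeniusPushforward A p 1 →+* FrobeniusPushforward B p 1 :=
    (FrobeniusPushforward.of B p 1 : B →+* _).comp ((algebraMap A B).comp
      ((FrobeniusPushforward.of A p 1).symm : _ →+* A))
  have hφ : φ.comp (algebraMap A (FrobeniusPushforward A p 1)) =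
      (algebraMap B (FrobeniusPushforward B p 1)).comp (algebraMap A B) :=
    RingHom.ext fun y => map_pow (algebraMap A B) y (p ^ 1)
  have hsub : ∀ y, y ∈ maximalIdeal A • (⊤ : Submodule A (FrobeniusPushforward A p 1)) →
      φ y ∈ maximalIdeal B • (⊤ : Submodule B (FrobeniusPushforward B p 1)) := by
    intro y hy
    rw [Ideal.smul_top_eq_map] at hy ⊢
    have h1 := Ideal.mem_map_of_mem φ hy
    rw [Ideal.map_map, hφ, ← Ideal.map_map, ← AdicCompletion.maximalIdeal_eq_map] at h1
    exact h1
  have key : ∀ y : FrobeniusPushforward B p 1, ∃ c : Fin r → B, y - ∑ i, c i • φ (a i) ∈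
      maximalIdeal B • (⊤ : Submodule B (FrobeniusPushforward B p 1)) := by
    -- Elements of `A` approximate `y` modulo `m^n`, with `n` so large that `m^n ⊆ m^{[p]}`; thus
    -- generators modulo `m` for `A` serve for the completion.
    intro y
    obtain ⟨n, hn⟩ := exists_maximalIdeal_pow_le_frobeniusPower (A := A) (p ^ 1)
    obtain ⟨z, hz⟩ := exists_sub_algebraMap_mem_map_pow ((FrobeniusPushforward.of B p 1).symm y) n
    obtain ⟨c, hc⟩ := h (FrobeniusPushforward.of A p 1 z)
    refine ⟨fun i => algebraMap A B (c i), ?_⟩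
    have h1 : y - φ (FrobeniusPushforward.of A p 1 z) ∈
        maximalIdeal B • (⊤ : Submodule B (FrobeniusPushforward B p 1)) := by
      have h2 : (maximalIdeal A ^ n).map (algebraMap A B) ≤
          frobeniusPower (maximalIdeal B) (p ^ 1) := by
        refine (Ideal.map_mono hn).trans ?_
        rw [frobeniusPower_eq_map, frobeniusPower_eq_map, Ideal.map_map,
          AdicCompletion.maximalIdeal_eq_map, Ideal.map_map]
        refine le_of_eq (congrArg (fun f => Ideal.map f _) (RingHom.ext fun y => ?_))
        exact map_pow (algebraMap A B) y (p ^ 1)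
      rw [Ideal.smul_top_eq_map]
      exact h2 hz
    have h3 := hsub _ hc
    have h4 : ∑ i, algebraMap A B (c i) • φ (a i) = φ (∑ i, c i • a i) := by
      rw [map_sum]
      refine Finset.sum_congr rfl fun i _ => ?_
      rw [Algebra.smul_def, Algebra.smul_def, map_mul]
      exact congrArg (· * φ (a i)) (RingHom.congr_fun hφ (c i)).symm
    rw [h4]
    have := add_mem h1 h3
    rwa [map_sub, sub_add_sub_cancel] at this
  obtain ⟨c, hc⟩ := FrobeniusPushforward.exists_eq_sum_smul (maximalIdeal B) (fun i => φ (a i)) key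
    (FrobeniusPushforward.of B p 1 x)
  refine ⟨c, (FrobeniusPushforward.of B p 1).injective (Eq.trans ?_ hc)⟩
  rw [map_sum]
  refine Finset.sum_congr rfl fun i _ => ?_
  rw [Algebra.smul_def, Algebra.smul_def, mul_comm, map_mul,
    FrobeniusPushforward.algebraMap_apply, pow_one]
  rfl

end Completion

section FrobeniusFinite

open IsLocalRing

/-- Let `N` be the span of generators of the pushforward `F` modulo `m`. After tensoring with the
completion `N` becomes all of `F`, so `N = F` by faithful flatness. -/
theorem frobenius_finite_of_isRegularHom {A : Type u} [CommRing A] [IsLocalRing A]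
    [IsNoetherianRing A] [IsDomain A] {p : ℕ} [Fact p.Prime] [CharP A p]
    [IsAlgClosed (ResidueField A)]
    (h : IsRegularHom A (AdicCompletion (maximalIdeal A) A)) : (frobenius A p).Finite := by
  set B := AdicCompletion (maximalIdeal A) A
  have hflat : Module.Flat A B := h.1
  have : Module.FaithfullyFlat A B := .of_flat_of_isLocalHom
  have : ExpChar B p := expChar_of_injective_algebraMap (FaithfulSMul.algebraMap_injective A B) p
  have hred : ∀ (L : Type u) [Field L] [Algebra (⊥ : Ideal A).ResidueField L],
      Module.Finite (⊥ : Ideal A).ResidueField L →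
      IsReduced (L ⊗[(⊥ : Ideal A).ResidueField] ((⊥ : Ideal A).ResidueField ⊗[A] B)) := by
    intro L _ _ hL
    have := h.2 ⊥ L hL
    exact isReduced_of_isRegularRing (L ⊗[(⊥ : Ideal A).ResidueField] (⊥ : Ideal A).Fiber B)
  have hinj : Function.Injective (algebraMap A (⊥ : Ideal A).ResidueField) :=
    (injective_iff_map_eq_zero _).mpr fun x hx => Ideal.algebraMap_residueField_eq_zero.mp hx
  obtain ⟨r, a, ha⟩ := FrobeniusPushforward.exists_fin_forall_sub_mem (A := A) (p := p) 1
  let F := FrobeniusPushforward A p 1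
  let N := Submodule.span A (Set.range a)
  have hmem : ∀ x : F, x ⊗ₜ[A] (1 : B) ∈ LinearMap.range (N.subtype.rTensor B) := by
    intro x
    obtain ⟨b, hb⟩ := exists_completion_eq_sum a ha
      (algebraMap A B ((FrobeniusPushforward.of A p 1).symm x))
    -- The relation `x = ∑ a_i b_i^p` is moved to one side, with `none` indexing the term `-x ·
    -- 1^p`; the lemma then yields `x ⊗ 1 = ∑ a_i ⊗ b_i`.
    have h0 := sum_tmul_eq_zero_of_forall_isReduced (Fact.out : p.Prime) hinj hred Finset.univ
      (fun i : Option (Fin r) => i.elim (-x) a) (fun i => i.elim 1 b) (by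
        rw [Fintype.sum_option]
        simp only [Option.elim_none, Option.elim_some, one_pow, hb, map_neg, neg_smul]
        rw [Algebra.algebraMap_eq_smul_one, neg_add_cancel])
    rw [Fintype.sum_option] at h0
    simp only [Option.elim_none, Option.elim_some, TensorProduct.neg_tmul] at h0
    rw [neg_add_eq_zero] at h0
    rw [h0]
    exact Submodule.sum_mem _ fun i _ =>
      ⟨⟨a i, Submodule.subset_span ⟨i, rfl⟩⟩ ⊗ₜ b i, rfl⟩
  have hsurj : Function.Surjective (N.subtype.lTensor B) := by
    rw [LinearMap.lTensor_surj_iff_rTensor_surj]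
    intro z
    induction z with
    | zero => exact ⟨0, map_zero _⟩
    | add y z hy hz =>
      obtain ⟨y, rfl⟩ := hy
      obtain ⟨z, rfl⟩ := hz
      exact ⟨y + z, map_add _ _ _⟩
    | tmul x b =>
      obtain ⟨w, hw⟩ := hmem x
      refine ⟨LinearMap.lTensor N (LinearMap.mulLeft A b) w, ?_⟩
      have := congrArg (LinearMap.lTensor F (LinearMap.mulLeft A b)) hw
      rw [LinearMap.lTensor_tmul, LinearMap.mulLeft_apply, mul_one] at this
      rw [← this, ← LinearMap.comp_apply, ← LinearMap.comp_apply, LinearMap.rTensor_comp_lTensor,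
        LinearMap.lTensor_comp_rTensor]
  have hN : N = ⊤ := by
    have := (Module.FaithfullyFlat.lTensor_surjective_iff_surjective A B N.subtype).mp hsurj
    rw [← LinearMap.range_eq_top, Submodule.range_subtype] at this
    exact this
  have hfin : Module.Finite A F :=
    ⟨hN ▸ Submodule.fg_span (Set.finite_range a)⟩
  have : (iterateFrobenius A p 1).Finite := hfin
  rwa [iterateFrobenius_one] at this

theorem frobenius_finite_of_ringEquiv {R S : Type*} [CommRing R] [CommRing S] {p : ℕ} [ExpChar R p]
    [ExpChar S p] (e : R ≃+* S) (h : (frobenius S p).Finite) : (frobenius R p).Finite := by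
  have h1 : frobenius R p = (e.symm : S →+* R).comp ((frobenius S p).comp (e : R →+* S)) :=
    RingHom.ext fun x => by simp [frobenius_def]
  rw [h1]
  exact (RingHom.Finite.of_surjective _ e.symm.surjective).comp
    (h.comp (RingHom.Finite.of_surjective _ e.surjective))

theorem frobenius_finite_of_isExcellentRing (R : Type u) [CommRing R] [IsLocalRing R] [IsDomain R]
    [IsExcellentRing R] (p : ℕ) [Fact p.Prime] [CharP R p] [IsAlgClosed (ResidueField R)] :
    (frobenius R p).Finite := by
  -- The formal fibre condition concerns the localization at `m`, which is `R` again up to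
  -- isomorphism.
  let A := Localization.AtPrime (maximalIdeal R)
  let e : R ≃+* A := (IsLocalization.atUnits R (maximalIdeal R).primeCompl
    (fun x => by simpa using! fun a => a)).toRingEquiv
  have : IsDomain A := MulEquiv.isDomain R e.symm.toMulEquiv
  have : CharP A p := charP_of_injective_ringHom (f := (e : R →+* A)) e.injective p
  have : IsAlgClosed (ResidueField A) :=
    IsAlgClosed.of_ringEquiv _ _ (ResidueField.mapEquiv e)
  exact frobenius_finite_of_ringEquiv e (frobenius_finite_of_isRegularHom
    (IsExcellentRing.regularFormalFibres (maximalIdeal R)))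

end FrobeniusFinite

end HilbertKunz

open HilbertKunz
theorem mainTheorem3 (p : ℕ) [Fact p.Prime] (R : Type u) [CommRing R] [IsLocalRing R]
    [IsDomain R] [IsIntegrallyClosed R] [IsExcellentRing R] [CharP R p]
    [IsAlgClosed (IsLocalRing.ResidueField R)] :
    (∀ I : Ideal R, IsMaximalPrimary I →
      Tendsto (hkSeq p I) atTop (𝓝 (hkMultiplicity p I))) ∧
    (∀ I : Ideal R, IsMaximalPrimary I → IsIntegrallyClosedIdeal I →
      hkMultiplicity p I ≥
        colength I + hkMultiplicity p (IsLocalRing.maximalIdeal R) - 1) ∧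
    (∀ I : Ideal R, IsMaximalPrimary I →
      (∃ K : Ideal R, K ≤ I ∧ IsIntegrallyClosedIdeal K ∧
        Module.length R (I ⧸ K.submoduleOf I) = 1) →
      hkMultiplicity p I ≥ colength I) := by
  have hF := frobenius_finite_of_isExcellentRing R p
  exact ⟨fun I hI => tendsto_hkSeq hF hI,
    fun I hI hIc => colength_add_hkMultiplicity_sub_one_le hF hI hIc,
    fun I hI ⟨K, hKI, hK, h⟩ => colength_le_hkMultiplicity hF hI hKI hK h⟩
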